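/- Setting. Let $A\subseteq\mathbb R$ be a nonempty closed convex set (for instance $A=\mathbb R$), $b:A\times\mathbb R\to\mathbb R$ and $f:\mathbb R\times A\times\mathbb R\to\mathbb R$ functions, and $\mu_0$ a probability measure on $\mathbb R$ with mean zero and finite second moment. Let $I=[0,1]$ with Lebesgue measure. Let $\mathcal K$ be the set of probability measures on $\mathbb R\times\mathbb R$ with first marginal $\mu_0$ and finite second moment, and put $$\tilde{\mathcal J}(\alpha,\nu)=\int f(b(\alpha,z)+\xi,\alpha,z)\,\nu(d\xi,dz),\qquad \mathcal J(\alpha,z)=\int f(b(\alpha,z)+\xi,\alpha,z)\,\mu_0(d\xi),$$ the integrals being assumed to exist for all $\alpha\in A$, $\nu\in\mathcal K$, $z\in\mathbb R$. Assume that there are constants $c_\alpha,c_z\ge 0$, $c_0,\ell_c>0$ and $\ell_J,\tilde\ell_J$ such that for all $\alpha,\alpha'\in A$, $z,z'\in\mathbb R$ and $\nu,\nu'\in\mathcal K$: * $|b(\alpha,z)-b(\alpha',z')|^2\le c_\alpha|\alpha-\alpha'|^2+c_z|z-z'|^2$ and $|b(\alpha,z)|\le c_0$; * $|\tilde{\mathcal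 J}(\alpha,\nu')-\tilde{\mathcal J}(\alpha,\nu)|\le\tilde\ell_J\,W_2(\nu,\nu')$, where $W_2$ is the 2-Wasserstein distance; * $\mathcal J(\cdot,z)$ is continuously differentiable on $A$ and strongly convex with constant $\ell_c$, i.e. $\mathcal J(\epsilon\alpha+(1-\epsilon)\alpha',z)\le\epsilon\mathcal J(\alpha,z)+(1-\epsilon)\mathcal J(\alpha',z)-\frac{\ell_c}{2}\epsilon(1-\epsilon)|\alpha-\alpha'|^2$ for $\epsilon\in[0,1]$, and $|\partial_\alpha\mathcal J(\alpha,z')-\partial_\alpha\mathcal J(\alpha,z)|\le\ell_J|z'-z|$. $N$-player game. Let $W$ be a symmetric real $N\times N$ matrix and $\xi_1,\dots,\xi_N$ i.i.d. random variables with law $\mu_0$ on a probability space $\Omega$. For $\boldsymbol\alpha\in A^N$ let $\mathbf z=\mathbf Z_N\boldsymbol\alpha\in L^2(\Omega;\mathbb R^N)$ be the solution of $z_i=\frac1N\sum_{j=1}^N W_{i,j}\,(b(\alpha_j,z_j)+\xi_j)$, $i=1,\dots,N$ (it exists and is unique if $c_z\frac1{N^2}\sum_{i,j}W_{i,j}^2<1$).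 The cost of player $i$ is $J_i(\boldsymbol\alpha)=\mathbb E[f(b(\alpha_i,z_i)+\xi_i,\alpha_i,z_i)]$, and $\boldsymbol\alpha\in A^N$ is a Nash equilibrium if no player $i$ can lower $J_i$ by replacing $\alpha_i$ alone by another action in $A$. Graphon game. A graphon is a symmetric, Borel measurable, square-integrable $w:I\times I\to\mathbb R$; $\|w\|_2$ is its $L^2(I\times I)$ norm, $\mathbf W g=\int_I w(\cdot,y)g(y)\,dy$ its operator on $L^2(I)$, and $\|\mathbf W\|$ the operator norm. When $\sqrt{c_z}\|\mathbf W\|<1$, for $\boldsymbol\alpha\in L^2(I)$ with values in $A$ let $\mathbf z=\mathbf Z\boldsymbol\alpha\in L^2(I)$ be the unique solution of $z_x=\int_I w(x,y)\,b(\alpha_y,z_y)\,dy$ for a.e. $x$. A Nash equilibrium of the graphon game with $w$ is an $\hat{\boldsymbol\alpha}\in L^2(I)$ with values in $A$ such that, for a.e. $x\in I$ and all $\beta\in A$, $\mathcal J(\hat\alpha_x,(\mathbf Z\hat{\boldsymbol\alpha})_x)\le\mathcal J(\beta,(\mathbf Z\hat{\boldsymbol\alpha})_x)$. Distances. Let $\mathcal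 S_I$ be the set of invertible bi-measurable Lebesgue-measure-preserving maps $I\to I$. Put $\|w\|_\square=\sup_{S,T\in\mathcal B(I)}|\int_{S\times T}w|$, $\delta_\square(w,w')=\inf_{\varphi\in\mathcal S_I}\|w(\varphi(\cdot),\varphi(\cdot))-w'\|_\square$ and $d_{\mathcal S}(\boldsymbol\alpha,\boldsymbol\alpha')=\inf_{\varphi\in\mathcal S_I}\|\boldsymbol\alpha\circ\varphi-\boldsymbol\alpha'\|_{L^2(I)}$. For $\boldsymbol\alpha\in A^N$ let $\psi^N(\boldsymbol\alpha)$ be the step function equal to $\alpha_i$ on $[\frac{i-1}N,\frac iN)$, and let $\Psi^N(W)$ be the step graphon equal to $W_{i,j}$ on $[\frac{i-1}N,\frac iN)\times[\frac{j-1}N,\frac jN)$. Theorem. Let $(W^N)_{N\ge1}$ be symmetric matrices, $W^N\in\mathbb R^{N\times N}$, such that for all sufficiently large $N$ (in particular, if for every $N\ge 1$) the $N$-player game with matrix $W^N$ has a unique Nash equilibrium $\boldsymbol\alpha^{N,*}$. Let $w^N=\Psi^N(W^N)$ with operator $\mathbf W^N$, and suppose there is a graphon $w$ with operator $\mathbf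 W$ such that $\delta_\square(w^N,w)\to0$, $\|w^N\|_2\to\|w\|_2$ and $\|\mathbf W^N\|\to\|\mathbf W\|$ as $N\to\infty$, and $$\sqrt{2c_z}\,\|w\|_2<1,\qquad\sqrt{c_z}\,\|\mathbf W\|<1,\qquad\frac{\ell_J}{\ell_c}\cdot\frac{\sqrt{c_\alpha}\,\|\mathbf W\|}{1-\sqrt{c_z}\,\|\mathbf W\|}<1.$$ Then the graphon game with $w$ has a unique Nash equilibrium $\hat{\boldsymbol\alpha}$, and $$\lim_{N\to\infty}d_{\mathcal S}\bigl(\psi^N(\boldsymbol\alpha^{N,*}),\hat{\boldsymbol\alpha}\bigr)=0.$$ -/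

import Mathlib

open MeasureTheory ProbabilityTheory Filter Topology unitInterval

noncomputable section

namespace GraphonGame

/-! ### Costs, and the assumptions on the data of the game

`A ⊆ ℝ` is the set of actions, `b (α, z)` the drift, `f (x, α, z)` the running cost and `μ₀` the
common law of the idiosyncratic shocks. The state of a player is `b α z + ξ`. The values of `b` and
`f` at actions outside `A` are irrelevant. -/

/-- The squared Lipschitz condition on `b` over `A × ℝ`. -/
def LipschitzDrift (A : Set ℝ) (b : ℝ → ℝ → ℝ) (cα cz : ℝ) : Prop :=
  0 ≤ cα ∧ 0 ≤ cz ∧ ∀ α ∈ A, ∀ α' ∈ A, ∀ z z' : ℝ,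
    |b α z - b α' z'| ^ 2 ≤ cα * |α - α'| ^ 2 + cz * |z - z'| ^ 2

/-- The law of the shocks is centred and has a finite second moment. -/
def CenteredSquareIntegrable (μ₀ : Measure ℝ) : Prop :=
  MemLp id 2 μ₀ ∧ ∫ ξ, ξ ∂μ₀ = 0

/-- `b` is bounded by `c₀` on `A × ℝ`. -/
def BoundedDrift (A : Set ℝ) (b : ℝ → ℝ → ℝ) (c₀ : ℝ) : Prop :=
  0 < c₀ ∧ ∀ α ∈ A, ∀ z : ℝ, |b α z| ≤ c₀

/-- The probability measures on `ℝ × ℝ` (pairs `(ξ, z)`) with first marginal `μ₀` and finite second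
moment; the first coordinate has a second moment because `μ₀` has one. -/
def ShockAggregateLaws (μ₀ : Measure ℝ) : Set (Measure (ℝ × ℝ)) :=
  {ν | IsProbabilityMeasure ν ∧ ν.map Prod.fst = μ₀ ∧ MemLp Prod.snd 2 ν}

/-- The cost `𝒥̃(α, ν)` of the action `α` when the pair (shock, aggregate) has law `ν`. -/
def costLaw (b : ℝ → ℝ → ℝ) (f : ℝ → ℝ → ℝ → ℝ) (α : ℝ) (ν : Measure (ℝ × ℝ)) : ℝ :=
  ∫ p, f (b α p.2 + p.1) α p.2 ∂ν

/-- The cost `𝒥(α, z)` of the action `α` when the aggregate is the deterministic number `z`. -/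
def cost (b : ℝ → ℝ → ℝ) (f : ℝ → ℝ → ℝ → ℝ) (μ₀ : Measure ℝ) (α z : ℝ) : ℝ :=
  ∫ ξ, f (b α z + ξ) α z ∂μ₀

/-- The expectations that define the costs exist. -/
def CostIntegrable (A : Set ℝ) (b : ℝ → ℝ → ℝ) (f : ℝ → ℝ → ℝ → ℝ) (μ₀ : Measure ℝ) : Prop :=
  ∀ α ∈ A, ∀ ν ∈ ShockAggregateLaws μ₀,
    Integrable (fun p : ℝ × ℝ => f (b α p.2 + p.1) α p.2) ν

/-- The `2`-Wasserstein distance on the Euclidean plane, through couplings. -/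
def wasserstein2 (ν ν' : Measure (ℝ × ℝ)) : ℝ :=
  Real.sqrt (ENNReal.toReal
    (⨅ π ∈ {π : Measure ((ℝ × ℝ) × (ℝ × ℝ)) | π.map Prod.fst = ν ∧ π.map Prod.snd = ν'},
      ∫⁻ q, ENNReal.ofReal ((q.1.1 - q.2.1) ^ 2 + (q.1.2 - q.2.2) ^ 2) ∂π))

/-- `𝒥̃(α, ·)` is Lipschitz for the `2`-Wasserstein distance, uniformly in `α ∈ A`. -/
def CostLawLipschitz (A : Set ℝ) (b : ℝ → ℝ → ℝ) (f : ℝ → ℝ → ℝ → ℝ) (μ₀ : Measure ℝ)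
    (lJt : ℝ) : Prop :=
  ∀ α ∈ A, ∀ ν ∈ ShockAggregateLaws μ₀, ∀ ν' ∈ ShockAggregateLaws μ₀,
    |costLaw b f α ν' - costLaw b f α ν| ≤ lJt * wasserstein2 ν ν'

/-- `𝒥(·, z)` is `C¹` and `ℓ_c`-strongly convex on `A`, and `∂_α 𝒥(α, ·)` is `ℓ_J`-Lipschitz. -/
def CostRegular (A : Set ℝ) (b : ℝ → ℝ → ℝ) (f : ℝ → ℝ → ℝ → ℝ) (μ₀ : Measure ℝ)
    (lc lJ : ℝ) : Prop :=
  0 < lc ∧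
  (∀ z : ℝ, ContDiffOn ℝ 1 (fun α => cost b f μ₀ α z) A ∧
    StrongConvexOn A lc (fun α => cost b f μ₀ α z)) ∧
  ∀ α ∈ A, ∀ z z' : ℝ,
    |derivWithin (fun a => cost b f μ₀ a z') A α - derivWithin (fun a => cost b f μ₀ a z) A α|
      ≤ lJ * |z' - z|

/-! ### The `N`-player game -/

section FinitePlayer

variable {N : ℕ} {Ω : Type*} [MeasurableSpace Ω]

/-- `z ∈ L²(Ω; ℝ^N)` is a family of aggregates for the profile `α`:
`z_i = (1/N) ∑_j W_{ij} (b(α_j, z_j) + ξ_j)` in `L²`. -/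
def IsAggregate (b : ℝ → ℝ → ℝ) (P : Measure Ω) (ξ : Fin N → Ω → ℝ)
    (W : Matrix (Fin N) (Fin N) ℝ) (α : Fin N → ℝ) (z : Fin N → Lp ℝ 2 P) : Prop :=
  ∀ i, (z i : Ω → ℝ) =ᵐ[P]
    fun ω => (1 / (N : ℝ)) * ∑ j, W i j * (b (α j) (z j ω) + ξ j ω)

/-- The aggregate operator `𝐙_N`: the element of `L²(Ω; ℝ^N)` that is a family of aggregates for `α`.
It exists and is unique whenever `√c_z ‖W‖_F < 1`. -/
def aggregate (b : ℝ → ℝ → ℝ) (P : Measure Ω) (ξ : Fin N → Ω → ℝ)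
    (W : Matrix (Fin N) (Fin N) ℝ) (α : Fin N → ℝ) : Fin N → Lp ℝ 2 P :=
  Classical.epsilon (IsAggregate b P ξ W α)

/-- The cost `J_i(α)` of player `i`. -/
def playerCost (b : ℝ → ℝ → ℝ) (f : ℝ → ℝ → ℝ → ℝ) (P : Measure Ω) (ξ : Fin N → Ω → ℝ)
    (W : Matrix (Fin N) (Fin N) ℝ) (i : Fin N) (α : Fin N → ℝ) : ℝ :=
  ∫ ω, f (b (α i) (aggregate b P ξ W α i ω) + ξ i ω) (α i) (aggregate b P ξ W α i ω) ∂P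

/-- Nash equilibria of the `N`-player game with interaction matrix `W`. -/
def IsNash (A : Set ℝ) (b : ℝ → ℝ → ℝ) (f : ℝ → ℝ → ℝ → ℝ) (P : Measure Ω)
    (ξ : Fin N → Ω → ℝ) (W : Matrix (Fin N) (Fin N) ℝ) (α : Fin N → ℝ) : Prop :=
  (∀ i, α i ∈ A) ∧ ∀ i, ∀ β ∈ A,
    playerCost b f P ξ W i α ≤ playerCost b f P ξ W i (Function.update α i β)

end FinitePlayer

/-! ### Graphons -/

/-- A graphon: a symmetric, measurable, square-integrable function on the unit square. -/
structure IsGraphon (w : I → I → ℝ) : Prop where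
  symm : ∀ x y, w x y = w y x
  measurable : Measurable (fun p : I × I => w p.1 p.2)
  integrable_sq : Integrable (fun p : I × I => w p.1 p.2 ^ 2)

/-- `‖w‖₂`. -/
def graphonNorm (w : I → I → ℝ) : ℝ :=
  Real.sqrt (∫ p : I × I, w p.1 p.2 ^ 2)

/-- The integral operator `[𝐖 g]_x = ∫ w(x, y) g(y) dy`. -/
def graphonOp (w : I → I → ℝ) (g : I → ℝ) (x : I) : ℝ :=
  ∫ y, w x y * g y

/-- The `L²` norm of a function on `I`. -/
def normL2 (g : I → ℝ) : ℝ := (eLpNorm g 2 volume).toReal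

/-- The operator norm of `𝐖` on `L²(I)`. -/
def graphonOpNorm (w : I → I → ℝ) : ℝ :=
  sSup {r | ∃ φ : Lp ℝ 2 (volume : Measure I), ‖φ‖ = 1 ∧ r = normL2 (graphonOp w φ)}

/-- The cut norm. -/
def cutNorm (w : I → I → ℝ) : ℝ :=
  sSup {r | ∃ S T : Set I, MeasurableSet S ∧ MeasurableSet T ∧
    r = |∫ p in S ×ˢ T, w p.1 p.2|}

/-- The invertible bi-measurable maps of `I` that preserve Lebesgue measure. -/
def MPEquiv : Type := {φ : I ≃ᵐ I // MeasurePreserving φ volume volume}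

/-- The cut distance `δ_□(w, w') = inf_φ ‖w^φ - w'‖_□`. -/
def cutDist (w w' : I → I → ℝ) : ℝ :=
  ⨅ φ : MPEquiv, cutNorm (fun x y => w (φ.1 x) (φ.1 y) - w' x y)

/-- The permutation-invariant `L²` distance `d_S(α, α') = inf_φ ‖α^φ - α'‖`. -/
def distS (α α' : I → ℝ) : ℝ :=
  ⨅ φ : MPEquiv, normL2 (fun x => α (φ.1 x) - α' x)

/-- The step function `ψ^N(α)`: with players numbered from `0`, its value on `[i/N, (i+1)/N)` is
`α_i`. The value at the point `1` is `0`. -/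
def stepFun {N : ℕ} (α : Fin N → ℝ) (x : I) : ℝ :=
  if h : ⌊(N : ℝ) * (x : ℝ)⌋₊ < N then α ⟨⌊(N : ℝ) * (x : ℝ)⌋₊, h⟩ else 0

/-- The step graphon `Ψ^N(W)`, equal to `W_{ij}` on `[i/N, (i+1)/N) × [j/N, (j+1)/N)`. -/
def stepGraphon {N : ℕ} (W : Matrix (Fin N) (Fin N) ℝ) (x y : I) : ℝ :=
  stepFun (fun i => stepFun (W i) y) x

/-! ### The graphon game -/

/-- The admissible strategy profiles: the elements of `L²(I)` with values in `A`. -/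
def Admissible (A : Set ℝ) : Set (Lp ℝ 2 (volume : Measure I)) :=
  {α | ∀ᵐ x, α x ∈ A}

/-- `z_x = ∫ w(x, y) b(α_y, z_y) dy` for almost every `x`. -/
def IsGraphonAggregate (b : ℝ → ℝ → ℝ) (w : I → I → ℝ)
    (α z : Lp ℝ 2 (volume : Measure I)) : Prop :=
  ∀ᵐ x, z x = ∫ y, w x y * b (α y) (z y)

/-- The aggregate operator `𝐙`: the solution `z ∈ L²(I)` of the fixed point equation. It exists and
is unique whenever `√c_z ‖𝐖‖ < 1`. -/
def graphonAggregate (b : ℝ → ℝ → ℝ) (w : I → I → ℝ)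
    (α : Lp ℝ 2 (volume : Measure I)) : Lp ℝ 2 (volume : Measure I) :=
  Classical.epsilon (IsGraphonAggregate b w α)

/-- The best responses to the profile `α` in the graphon game. The cost of player `x` is
`J_x(β, α) = 𝔼[f(b(β, z_x) + ξ_x, β, z_x)] = 𝒥(β, z_x)` with `z = 𝐙α`, since `ξ_x` has law `μ₀`. -/
def bestResponses (A : Set ℝ) (b : ℝ → ℝ → ℝ) (f : ℝ → ℝ → ℝ → ℝ) (μ₀ : Measure ℝ)
    (w : I → I → ℝ) (α : Lp ℝ 2 (volume : Measure I)) : Set (Lp ℝ 2 (volume : Measure I)) :=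
  {α' | α' ∈ Admissible A ∧ ∀ᵐ x, ∀ β ∈ A,
    cost b f μ₀ (α' x) (graphonAggregate b w α x) ≤ cost b f μ₀ β (graphonAggregate b w α x)}

/-- Nash equilibria of the graphon game: admissible fixed points of the best response map. -/
def IsGraphonNash (A : Set ℝ) (b : ℝ → ℝ → ℝ) (f : ℝ → ℝ → ℝ → ℝ) (μ₀ : Measure ℝ)
    (w : I → I → ℝ) (α : Lp ℝ 2 (volume : Measure I)) : Prop :=
  α ∈ Admissible A ∧ α ∈ bestResponses A b f μ₀ w α

end GraphonGame

end

namespace GraphonGame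

/-! ### Minimizers of strongly convex functions -/

/-! Strong convexity makes the best reply `a z` to a deterministic aggregate `z` unique and
Lipschitz in `z` with constant `lJ / lc` (`CostRegular.exists_bestReply`). A graphon equilibrium is
therefore `a ∘ z` with `z = 𝐖 b(a(z), z)`. The last smallness hypothesis, rearranged as `‖𝐖‖ (√cα *
lJ / lc + √cz) < 1`, makes the right-hand side a contraction of `L²(I)`, so Banach's theorem gives
existence and uniqueness (`existsUnique_graphonNash`).

For the limit, let `zbar` solve the `N`-player system for the equilibrium profile with the shocks
removed. The interaction system is stable because `2 * cz * ‖w^N‖₂² < 1` for large `N`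
(`interaction_stability`), and two perturbations have to be controlled. The shocks are orthogonal in
`L²(Ω)`, so they move all aggregates together by a bounded amount in squared norm. A deviation of
player `i` acts only through column `i` of `W / N`, so the effects on the players' own aggregates
also have a bounded sum of squares. By Cauchy–Schwarz the errors in the Nash inequalities, tested
with the deviation `a (zbar i)`, sum to `O(√N)`; the Wasserstein Lipschitz bound carries them to the
costs, and quadratic growth of the cost yields `(1/N) ∑ (α i - a (zbar i))² = O(N^{-1/2})`
(`exists_aggregate_sum_sq_le`).

After near-optimal relabellings, cut convergence gives weak convergence of the graphons in `L²(I ×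
I)`, and convergence of the norms upgrades it to strong convergence (`exists_relabelling`).
Comparing the equation of `zbar` with that of `z`, the contraction for the limit `w` bounds the
distance of the profiles by the best-reply error plus the `L²` distance of the graphons
(`distS_stepFun_le`). -/

theorem strongConvexOn_le {A : Set ℝ} {m : ℝ} {g : ℝ → ℝ} (hg : StrongConvexOn A m g)
    {x y t : ℝ} (hx : x ∈ A) (hy : y ∈ A) (ht₀ : 0 ≤ t) (ht₁ : t ≤ 1) :
    g (x + t * (y - x)) ≤ (1 - t) * g x + t * g y - t * (1 - t) * (m / 2 * (y - x) ^ 2) := by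
  have h := hg.2 hx hy (sub_nonneg.2 ht₁) ht₀ (by ring)
  simp only [smul_eq_mul, Real.norm_eq_abs, sq_abs] at h
  have h1 : (1 - t) * x + t * y = x + t * (y - x) := by ring
  rw [h1] at h
  linarith [sq_nonneg (x - y), show t * (1 - t) * (m / 2 * (y - x) ^ 2)
    = (1 - t) * t * (m / 2 * (x - y) ^ 2) by ring]

/-- A strongly convex function grows quadratically away from its minimizer. -/
theorem strongConvexOn_quadratic_growth {A : Set ℝ} {m : ℝ} {g : ℝ → ℝ}
    (hg : StrongConvexOn A m g) {a β : ℝ} (ha : a ∈ A) (hmin : ∀ x ∈ A, g a ≤ g x)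
    (hβ : β ∈ A) : g a + m / 2 * (β - a) ^ 2 ≤ g β := by
  -- Compare `a` with the point at fraction `t` of the segment towards `β` and divide by `t`; the
  -- claim is the limit `t → 0`.
  have key : ∀ t ∈ Set.Ioo (0 : ℝ) 1, (1 - t) * (m / 2 * (β - a) ^ 2) ≤ g β - g a := by
    rintro t ⟨ht₀, ht₁⟩
    have hmem : a + t * (β - a) ∈ A := by
      have := hg.1 ha hβ (sub_nonneg.2 ht₁.le) ht₀.le (by ring)
      simp only [smul_eq_mul] at this
      convert this using 1
      ring
    have h1 := strongConvexOn_le hg ha hβ ht₀.le ht₁.le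
    have h2 := hmin _ hmem
    have h3 : t * ((1 - t) * (m / 2 * (β - a) ^ 2)) ≤ t * (g β - g a) := by nlinarith
    exact le_of_mul_le_mul_left h3 ht₀
  have hlim : Tendsto (fun t : ℝ => (1 - t) * (m / 2 * (β - a) ^ 2)) (𝓝[>] 0)
      (𝓝 ((1 - 0) * (m / 2 * (β - a) ^ 2))) := by
    refine Tendsto.mono_left ?_ nhdsWithin_le_nhds
    exact (Continuous.tendsto (by fun_prop) 0)
  have := le_of_tendsto hlim
    (Filter.eventually_of_mem (Ioo_mem_nhdsGT one_pos) key)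
  linarith

/-- A continuous strongly convex function on a nonempty closed subset of `ℝ` has a minimizer. -/
theorem strongConvexOn_exists_min {A : Set ℝ} {m : ℝ} {g : ℝ → ℝ} (hm : 0 < m)
    (hA : A.Nonempty) (hAc : IsClosed A) (hg : StrongConvexOn A m g) (hgc : ContinuousOn g A) :
    ∃ a ∈ A, ∀ x ∈ A, g a ≤ g x := by
  obtain ⟨x₀, hx₀⟩ := hA
  have hcpt : ∀ r, IsCompact (A ∩ Metric.closedBall x₀ r) := fun r =>
    (isCompact_closedBall x₀ r).inter_left hAc
  have hmin : ∀ r, 0 ≤ r → ∃ p ∈ A ∩ Metric.closedBall x₀ r,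
      ∀ x ∈ A ∩ Metric.closedBall x₀ r, g p ≤ g x := fun r hr => by
    obtain ⟨p, hp, hp'⟩ := (hcpt r).exists_isMinOn
      ⟨x₀, hx₀, Metric.mem_closedBall_self hr⟩ (hgc.mono Set.inter_subset_left)
    exact ⟨p, hp, fun x hx => hp' hx⟩
  obtain ⟨p, hp, hpmin⟩ := hmin 1 zero_le_one
  have hpx : g p ≤ g x₀ := hpmin x₀ ⟨hx₀, Metric.mem_closedBall_self zero_le_one⟩
  -- On the segment from `x₀` to a point at distance `r > 1`, the point at distance `1` has value at
  -- least `g p`. Strong convexity then forces `g x ≥ g x₀` as soon as `m * (r - 1) ≥ 2 * (g x₀ - g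
  -- p)`, which is the meaning of `R`.
  set R : ℝ := 1 + 2 * (g x₀ - g p) / m with hR
  have hR1 : 1 ≤ R := by
    have : 0 ≤ 2 * (g x₀ - g p) / m := by
      apply div_nonneg _ hm.le
      linarith
    linarith
  have hfar : ∀ x ∈ A, R < |x - x₀| → g x₀ ≤ g x := by
    intro x hx hxr
    set r := |x - x₀| with hr
    have hr1 : 1 < r := lt_of_le_of_lt hR1 hxr
    have hr0 : 0 < r := by linarith
    have ht1 : r⁻¹ ≤ 1 := inv_le_one_of_one_le₀ hr1.le
    have hmem : x₀ + r⁻¹ * (x - x₀) ∈ A := by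
      have := hg.1 hx₀ hx (sub_nonneg.2 ht1) (inv_nonneg.2 hr0.le) (by ring)
      simp only [smul_eq_mul] at this
      convert this using 1
      ring
    have hball : x₀ + r⁻¹ * (x - x₀) ∈ Metric.closedBall x₀ 1 := by
      rw [Metric.mem_closedBall, Real.dist_eq, add_sub_cancel_left, abs_mul, ← hr, abs_inv,
        abs_of_pos hr0, inv_mul_cancel₀ hr0.ne']
    have h1 := hpmin _ ⟨hmem, hball⟩
    have h2 := strongConvexOn_le hg hx₀ hx (inv_nonneg.2 hr0.le) ht1
    rw [← sq_abs (x - x₀), ← hr] at h2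
    have h3 : r * g p ≤ (r - 1) * g x₀ + g x - (r - 1) * (m / 2 * r) := by
      calc r * g p ≤ r * ((1 - r⁻¹) * g x₀ + r⁻¹ * g x - r⁻¹ * (1 - r⁻¹) * (m / 2 * r ^ 2)) :=
            mul_le_mul_of_nonneg_left (h1.trans h2) hr0.le
        _ = _ := by field_simp
    have h4 : 2 * (g x₀ - g p) < m * (r - 1) := by
      have : 2 * (g x₀ - g p) / m < r - 1 := by linarith
      rw [div_lt_iff₀ hm] at this
      linarith
    nlinarith
  obtain ⟨a, ha, hamin⟩ := hmin R (by linarith)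
  refine ⟨a, ha.1, fun x hx => ?_⟩
  rcases le_or_gt |x - x₀| R with h | h
  · exact hamin x ⟨hx, by rwa [Metric.mem_closedBall, Real.dist_eq]⟩
  · exact (hamin x₀ ⟨hx₀, Metric.mem_closedBall_self (by linarith)⟩).trans (hfar x hx h)

theorem CostRegular.lJ_nonneg {A : Set ℝ} {b : ℝ → ℝ → ℝ} {f : ℝ → ℝ → ℝ → ℝ}
    {μ₀ : Measure ℝ} {lc lJ : ℝ} (hJ : CostRegular A b f μ₀ lc lJ) (hA : A.Nonempty) :
    0 ≤ lJ := by
  obtain ⟨α, hα⟩ := hA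
  have := (abs_nonneg _).trans (hJ.2.2 α hα 0 1)
  simpa using this

/-- The best reply to a deterministic aggregate: the minimizer of `cost · z`, with quadratic growth
of the cost, depends on `z` in a Lipschitz way. -/
theorem CostRegular.exists_bestReply {A : Set ℝ} {b : ℝ → ℝ → ℝ} {f : ℝ → ℝ → ℝ → ℝ}
    {μ₀ : Measure ℝ} {lc lJ : ℝ} (hJ : CostRegular A b f μ₀ lc lJ)
    (hA : A.Nonempty) (hAc : IsClosed A) (hAconv : Convex ℝ A) :
    ∃ a : ℝ → ℝ, (∀ z, a z ∈ A) ∧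
      (∀ z, ∀ β ∈ A, cost b f μ₀ (a z) z + lc / 2 * (β - a z) ^ 2 ≤ cost b f μ₀ β z) ∧
      ∀ z z', |a z - a z'| ≤ lJ / lc * |z - z'| := by
  have hlc := hJ.1
  choose a haA hamin using fun z => strongConvexOn_exists_min hlc hA hAc (hJ.2.1 z).2
    (hJ.2.1 z).1.continuousOn
  have hgrowth : ∀ z, ∀ β ∈ A,
      cost b f μ₀ (a z) z + lc / 2 * (β - a z) ^ 2 ≤ cost b f μ₀ β z := fun z β hβ =>
    strongConvexOn_quadratic_growth (hJ.2.1 z).2 (haA z) (hamin z) hβ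
  refine ⟨a, haA, hgrowth, fun z z' => ?_⟩
  have hd : ∀ z, DifferentiableOn ℝ (fun α => cost b f μ₀ α z) A := fun z =>
    (hJ.2.1 z).1.differentiableOn one_ne_zero
  by_cases hne : a z = a z'
  · rw [hne, sub_self, abs_zero]
    exact mul_nonneg (div_nonneg (hJ.lJ_nonneg hA) hlc.le) (abs_nonneg _)
  -- Adding the growth inequalities at `z` and `z'` bounds `lc * |a z - a z'|²` by an increment of
  -- `cost · z - cost · z'`, whose derivative is at most `lJ * |z - z'|`.
  have hmv := hAconv.norm_image_sub_le_of_norm_derivWithin_le (𝕜 := ℝ)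
    (f := fun α => cost b f μ₀ α z - cost b f μ₀ α z') (C := lJ * |z - z'|)
    ((hd z).sub (hd z')) (fun x hx => by
      by_cases hu : UniqueDiffWithinAt ℝ A x
      · rw [derivWithin_fun_sub (hd z x hx) (hd z' x hx)]
        exact hJ.2.2 x hx z' z
      -- Where derivatives within `A` are not unique, `derivWithin` has the default value `0`.
      · rw [derivWithin_zero_of_not_uniqueDiffWithinAt hu, norm_zero]
        exact mul_nonneg (hJ.lJ_nonneg hA) (abs_nonneg _)) (haA z) (haA z')
  simp only [Real.norm_eq_abs] at hmv
  have h1 := hgrowth z (a z') (haA z')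
  have h2 := hgrowth z' (a z) (haA z)
  have hpos : 0 < |a z - a z'| := abs_pos.2 (sub_ne_zero.2 hne)
  have hsq : (a z' - a z) ^ 2 = |a z - a z'| * |a z - a z'| := by
    rw [abs_mul_abs_self]; ring
  have hsq' : (a z - a z') ^ 2 = |a z - a z'| * |a z - a z'| := by
    rw [abs_mul_abs_self]; ring
  rw [abs_sub_comm (a z') (a z)] at hmv
  have h3 := (le_abs_self _).trans hmv
  rw [hsq] at h1
  rw [hsq'] at h2
  have h4 : |a z - a z'| * (lc * |a z - a z'|) ≤ |a z - a z'| * (lJ * |z - z'|) := by nlinarith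
  have h5 := le_of_mul_le_mul_left h4 hpos
  rw [div_mul_eq_mul_div, le_div_iff₀ hlc]
  linarith

theorem LipschitzDrift.abs_sub_le {A : Set ℝ} {b : ℝ → ℝ → ℝ} {cα cz : ℝ}
    (hb : LipschitzDrift A b cα cz) {α α' : ℝ} (hα : α ∈ A) (hα' : α' ∈ A) (z z' : ℝ) :
    |b α z - b α' z'| ≤ √cα * |α - α'| + √cz * |z - z'| := by
  have h := hb.2.2 α hα α' hα' z z'
  refine abs_le_of_sq_le_sq' ?_ (by positivity) |>.2
  have h1 := Real.sq_sqrt hb.1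
  have h2 := Real.sq_sqrt hb.2.1
  have : 0 ≤ 2 * (√cα * |α - α'|) * (√cz * |z - z'|) := by positivity
  nlinarith

theorem LipschitzDrift.abs_sub_le_right {A : Set ℝ} {b : ℝ → ℝ → ℝ} {cα cz : ℝ}
    (hb : LipschitzDrift A b cα cz) {α : ℝ} (hα : α ∈ A) (z z' : ℝ) :
    |b α z - b α z'| ≤ √cz * |z - z'| := by
  have h := hb.abs_sub_le hα hα z z'
  rwa [sub_self, abs_zero, mul_zero, zero_add] at h

/-! ### Square-integrable functions -/

section SquareIntegrable

variable {X : Type*} [MeasurableSpace X] {μ : Measure X}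

theorem inner_toLp {f g : X → ℝ} (hf : MemLp f 2 μ) (hg : MemLp g 2 μ) :
    inner ℝ (hf.toLp f) (hg.toLp g) = ∫ x, f x * g x ∂μ := by
  rw [L2.inner_def]
  refine integral_congr_ae ?_
  filter_upwards [hf.coeFn_toLp, hg.coeFn_toLp] with x hx hy
  rw [hx, hy]
  simp [mul_comm]

theorem norm_toLp_sq {f : X → ℝ} (hf : MemLp f 2 μ) :
    ‖hf.toLp f‖ ^ 2 = ∫ x, f x ^ 2 ∂μ := by
  rw [← real_inner_self_eq_norm_sq, inner_toLp]
  simp only [sq]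

theorem norm_Lp_sq (f : Lp ℝ 2 μ) : ‖f‖ ^ 2 = ∫ x, f x ^ 2 ∂μ := by
  rw [← norm_toLp_sq (Lp.memLp f), Lp.toLp_coeFn]

theorem integral_mul_sq_le {f g : X → ℝ} (hf : MemLp f 2 μ) (hg : MemLp g 2 μ) :
    (∫ x, f x * g x ∂μ) ^ 2 ≤ (∫ x, f x ^ 2 ∂μ) * ∫ x, g x ^ 2 ∂μ := by
  rw [← inner_toLp hf hg, ← norm_toLp_sq hf, ← norm_toLp_sq hg, ← mul_pow]
  exact sq_le_sq' (neg_le_of_abs_le (abs_real_inner_le_norm _ _)) (real_inner_le_norm _ _)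

end SquareIntegrable

theorem normL2_nonneg (g : I → ℝ) : 0 ≤ normL2 g := ENNReal.toReal_nonneg

theorem normL2_eq_norm_toLp {g : I → ℝ} (hg : MemLp g 2 volume) : normL2 g = ‖hg.toLp g‖ :=
  (Lp.norm_toLp g hg).symm

theorem normL2_coe (g : Lp ℝ 2 (volume : Measure I)) : normL2 g = ‖g‖ := (Lp.norm_def g).symm

theorem normL2_sq {g : I → ℝ} (hg : MemLp g 2 volume) : normL2 g ^ 2 = ∫ x, g x ^ 2 := by
  rw [normL2_eq_norm_toLp hg, norm_toLp_sq]

theorem normL2_congr {g h : I → ℝ} (hgh : g =ᵐ[volume] h) : normL2 g = normL2 h := by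
  rw [normL2, normL2, eLpNorm_congr_ae hgh]

theorem normL2_add_le {g h : I → ℝ} (hg : MemLp g 2 volume) (hh : MemLp h 2 volume) :
    normL2 (fun x => g x + h x) ≤ normL2 g + normL2 h := by
  have e : normL2 (fun x => g x + h x) = ‖hg.toLp g + hh.toLp h‖ := by
    rw [← MemLp.toLp_add, Lp.norm_toLp]; rfl
  rw [e, normL2_eq_norm_toLp hg, normL2_eq_norm_toLp hh]
  exact norm_add_le _ _

theorem normL2_mono {g h : I → ℝ} (hh : MemLp h 2 volume) (hgh : ∀ᵐ x, |g x| ≤ |h x|) :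
    normL2 g ≤ normL2 h :=
  ENNReal.toReal_mono hh.eLpNorm_ne_top (eLpNorm_mono_ae hgh)

theorem normL2_const_mul (c : ℝ) (g : I → ℝ) : normL2 (fun x => c * g x) = |c| * normL2 g := by
  have := eLpNorm_const_smul c g 2 (volume : Measure I)
  rw [normL2, show (fun x => c * g x) = c • g from rfl, this, ENNReal.toReal_mul]
  simp [normL2]

theorem normL2_abs (g : I → ℝ) : normL2 (fun x => |g x|) = normL2 g := by
  rw [normL2, normL2, ← eLpNorm_norm g]
  rfl

/-- Two-term domination: `|g| ≤ c |h| + d |k|` almost everywhere passes to the `L²` norms. -/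
theorem normL2_le_of_abs_le {g h k : I → ℝ} {c d : ℝ} (hc : 0 ≤ c) (hd : 0 ≤ d)
    (hh : MemLp h 2 volume) (hk : MemLp k 2 volume)
    (hle : ∀ᵐ x, |g x| ≤ c * |h x| + d * |k x|) :
    normL2 g ≤ c * normL2 h + d * normL2 k := by
  have h1 : MemLp (fun x => c * |h x|) 2 volume := hh.abs.const_mul c
  have h2 : MemLp (fun x => d * |k x|) 2 volume := hk.abs.const_mul d
  calc normL2 g ≤ normL2 (fun x => c * |h x| + d * |k x|) := by
        refine normL2_mono (h1.add h2) ?_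
        filter_upwards [hle] with x hx
        exact hx.trans (le_abs_self _)
    _ ≤ _ := normL2_add_le h1 h2
    _ = _ := by
        rw [normL2_const_mul, normL2_const_mul, normL2_abs, normL2_abs, abs_of_nonneg hc,
          abs_of_nonneg hd]

theorem normL2_comp {φ : I → I} (hφ : MeasurePreserving φ volume volume) {g : I → ℝ}
    (hg : AEStronglyMeasurable g volume) : normL2 (fun x => g (φ x)) = normL2 g := by
  rw [normL2, normL2, ← eLpNorm_comp_measurePreserving hg hφ]
  rfl

theorem normL2_le_of_bound {g : I → ℝ} {c : ℝ} (hc : 0 ≤ c) (h : ∀ᵐ x, |g x| ≤ c) :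
    normL2 g ≤ c := by
  have h1 : normL2 (fun _ : I => c) = c := by
    rw [normL2, eLpNorm_const _ two_ne_zero (NeZero.ne _)]
    simp [abs_of_nonneg hc]
  rw [← h1]
  refine normL2_mono (memLp_const c) ?_
  filter_upwards [h] with x hx
  rwa [abs_of_nonneg hc]

/-! ### The operator of a graphon -/

theorem graphonNorm_nonneg (w : I → I → ℝ) : 0 ≤ graphonNorm w := Real.sqrt_nonneg _

theorem graphonNorm_sq (w : I → I → ℝ) : graphonNorm w ^ 2 = ∫ p : I × I, w p.1 p.2 ^ 2 :=
  Real.sq_sqrt (integral_nonneg fun _ => sq_nonneg _)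

theorem IsGraphon.memLp {w : I → I → ℝ} (hw : IsGraphon w) :
    MemLp (fun p : I × I => w p.1 p.2) 2 volume :=
  (memLp_two_iff_integrable_sq hw.measurable.aestronglyMeasurable).2 hw.integrable_sq

theorem IsGraphon.ae_memLp {w : I → I → ℝ} (hw : IsGraphon w) :
    ∀ᵐ x, MemLp (w x) 2 volume := by
  have h := hw.integrable_sq
  rw [Measure.volume_eq_prod] at h
  filter_upwards [h.prod_right_ae] with x hx
  exact (memLp_two_iff_integrable_sq
    (hw.measurable.comp measurable_prodMk_left).aestronglyMeasurable).2 hx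

theorem IsGraphon.sub {w w' : I → I → ℝ} (hw : IsGraphon w) (hw' : IsGraphon w') :
    IsGraphon (fun x y => w x y - w' x y) where
  symm x y := by rw [hw.symm, hw'.symm]
  measurable := hw.measurable.sub hw'.measurable
  integrable_sq := (hw.memLp.sub hw'.memLp).integrable_sq

theorem IsGraphon.aestronglyMeasurable_op {w : I → I → ℝ} (hw : IsGraphon w) {u : I → ℝ}
    (hu : MemLp u 2 volume) : AEStronglyMeasurable (graphonOp w u) volume := by
  have : AEStronglyMeasurable (fun p : I × I => w p.1 p.2 * u p.2) (volume.prod volume) :=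
    hw.measurable.aestronglyMeasurable.mul hu.1.comp_snd
  exact this.integral_prod_right'

theorem IsGraphon.op_sq_le {w : I → I → ℝ} (hw : IsGraphon w) {u : I → ℝ}
    (hu : MemLp u 2 volume) :
    ∀ᵐ x, graphonOp w u x ^ 2 ≤ (∫ y, w x y ^ 2) * normL2 u ^ 2 := by
  filter_upwards [hw.ae_memLp] with x hx
  rw [normL2_sq hu]
  exact integral_mul_sq_le hx hu

theorem IsGraphon.integrable_integral_sq {w : I → I → ℝ} (hw : IsGraphon w) :
    Integrable (fun x => ∫ y, w x y ^ 2) := by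
  have h := hw.integrable_sq
  rw [Measure.volume_eq_prod] at h
  exact h.integral_prod_left

theorem IsGraphon.memLp_op {w : I → I → ℝ} (hw : IsGraphon w) {u : I → ℝ}
    (hu : MemLp u 2 volume) : MemLp (graphonOp w u) 2 volume := by
  have hm := hw.aestronglyMeasurable_op hu
  rw [memLp_two_iff_integrable_sq hm]
  refine (hw.integrable_integral_sq.mul_const (normL2 u ^ 2)).mono' (hm.pow 2) ?_
  filter_upwards [hw.op_sq_le hu] with x hx
  rwa [Real.norm_eq_abs, abs_of_nonneg (sq_nonneg _)]

/-- The Hilbert–Schmidt bound. -/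
theorem IsGraphon.normL2_op_le_graphonNorm {w : I → I → ℝ} (hw : IsGraphon w) {u : I → ℝ}
    (hu : MemLp u 2 volume) : normL2 (graphonOp w u) ≤ graphonNorm w * normL2 u := by
  refine abs_le_of_sq_le_sq' ?_ (mul_nonneg (graphonNorm_nonneg _) (normL2_nonneg _)) |>.2
  rw [normL2_sq (hw.memLp_op hu), mul_pow, graphonNorm_sq, Measure.volume_eq_prod,
    integral_prod _ (by rw [← Measure.volume_eq_prod]; exact hw.integrable_sq),
    ← integral_mul_const]
  exact integral_mono_ae (hw.memLp_op hu).integrable_sq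
    (hw.integrable_integral_sq.mul_const _) (hw.op_sq_le hu)

theorem graphonOpNorm_nonneg (w : I → I → ℝ) : 0 ≤ graphonOpNorm w := by
  refine Real.sSup_nonneg ?_
  rintro r ⟨φ, -, rfl⟩
  exact normL2_nonneg _

theorem graphonOp_congr (w : I → I → ℝ) {u v : I → ℝ} (h : u =ᵐ[volume] v) :
    graphonOp w u = graphonOp w v := by
  funext x
  refine integral_congr_ae ?_
  filter_upwards [h] with y hy
  rw [hy]

theorem graphonOp_const_mul (w : I → I → ℝ) (c : ℝ) (u : I → ℝ) :
    graphonOp w (fun y => c * u y) = fun x => c * graphonOp w u x := by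
  funext x
  rw [graphonOp, graphonOp, ← integral_const_mul]
  congr 1
  funext y
  ring

/-- Rescale `u` to norm one. The Hilbert–Schmidt bound shows that the supremum defining
`graphonOpNorm` is over a bounded set, and settles the case of a null `u`. -/
theorem IsGraphon.normL2_op_le {w : I → I → ℝ} (hw : IsGraphon w) {u : I → ℝ}
    (hu : MemLp u 2 volume) : normL2 (graphonOp w u) ≤ graphonOpNorm w * normL2 u := by
  rcases (normL2_nonneg u).eq_or_lt with h0 | hpos
  · have := hw.normL2_op_le_graphonNorm hu
    rw [← h0, mul_zero] at this ⊢
    exact this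
  have hbdd : BddAbove {r | ∃ φ : Lp ℝ 2 (volume : Measure I), ‖φ‖ = 1 ∧
      r = normL2 (graphonOp w φ)} := by
    refine ⟨graphonNorm w, ?_⟩
    rintro r ⟨φ, hφ, rfl⟩
    have := hw.normL2_op_le_graphonNorm (Lp.memLp φ)
    rwa [normL2_coe, hφ, mul_one] at this
  have hv : MemLp (fun y => (normL2 u)⁻¹ * u y) 2 volume := hu.const_mul _
  have hnorm : ‖hv.toLp _‖ = 1 := by
    rw [← normL2_eq_norm_toLp hv, normL2_const_mul, abs_of_nonneg (inv_nonneg.2 hpos.le),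
      inv_mul_cancel₀ hpos.ne']
  have h1 := le_csSup hbdd ⟨hv.toLp _, hnorm, rfl⟩
  rw [graphonOp_congr w hv.coeFn_toLp, graphonOp_const_mul, normL2_const_mul,
    abs_of_nonneg (inv_nonneg.2 hpos.le), inv_mul_le_iff₀ hpos] at h1
  rw [mul_comm]
  exact h1

theorem IsGraphon.op_sub {w : I → I → ℝ} (hw : IsGraphon w) {u v : I → ℝ}
    (hu : MemLp u 2 volume) (hv : MemLp v 2 volume) :
    ∀ᵐ x, graphonOp w u x - graphonOp w v x = graphonOp w (fun y => u y - v y) x := by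
  filter_upwards [hw.ae_memLp] with x hx
  simp only [graphonOp, mul_sub]
  exact (integral_sub (hx.integrable_mul hu) (hx.integrable_mul hv)).symm

theorem IsGraphon.sub_op {w w' : I → I → ℝ} (hw : IsGraphon w) (hw' : IsGraphon w') {u : I → ℝ}
    (hu : MemLp u 2 volume) :
    ∀ᵐ x, graphonOp w u x - graphonOp w' u x =
      graphonOp (fun x y => w x y - w' x y) u x := by
  filter_upwards [hw.ae_memLp, hw'.ae_memLp] with x hx hx'
  simp only [graphonOp, sub_mul]
  exact (integral_sub (hx.integrable_mul hu) (hx'.integrable_mul hu)).symm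

/-- A Lipschitz Hammerstein equation `z = 𝐖 g(·, z)` with `L ‖𝐖‖ < 1` is uniquely solvable. -/
theorem IsGraphon.existsUnique_hammerstein {w : I → I → ℝ} (hw : IsGraphon w) {g : I → ℝ → ℝ}
    {L : ℝ} (hL : 0 ≤ L) (hL1 : graphonOpNorm w * L < 1)
    (hmem : ∀ z : Lp ℝ 2 (volume : Measure I), MemLp (fun y => g y (z y)) 2 volume)
    (hlip : ∀ᵐ y, ∀ s t, |g y s - g y t| ≤ L * |s - t|) :
    ∃! z : Lp ℝ 2 (volume : Measure I), ∀ᵐ x, z x = ∫ y, w x y * g y (z y) := by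
  set T : Lp ℝ 2 (volume : Measure I) → Lp ℝ 2 (volume : Measure I) :=
    fun z => (hw.memLp_op (hmem z)).toLp _ with hT
  have hfix : ∀ z, (∀ᵐ x, z x = ∫ y, w x y * g y (z y)) ↔ Function.IsFixedPt T z := by
    intro z
    constructor
    · intro h
      refine Lp.ext ?_
      filter_upwards [h, (hw.memLp_op (hmem z)).coeFn_toLp] with x hx hx'
      rw [hx, hx']
      rfl
    · intro h
      have hc := (hw.memLp_op (hmem z)).coeFn_toLp
      have hz : (hw.memLp_op (hmem z)).toLp _ = z := h
      rw [hz] at hc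
      exact hc
  have hcontr : ContractingWith ⟨graphonOpNorm w * L, mul_nonneg (graphonOpNorm_nonneg w) hL⟩ T := by
    refine ⟨by exact_mod_cast hL1, LipschitzWith.of_dist_le_mul fun z z' => ?_⟩
    have hsub := (hmem z).sub (hmem z')
    have hzz : MemLp (fun y => z y - z' y) 2 volume := (Lp.memLp z).sub (Lp.memLp z')
    rw [dist_eq_norm, dist_eq_norm, hT]
    change ‖(hw.memLp_op (hmem z)).toLp _ - (hw.memLp_op (hmem z')).toLp _‖ ≤
      graphonOpNorm w * L * ‖z - z'‖
    rw [← MemLp.toLp_sub, Lp.norm_toLp]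
    change normL2 (fun x => graphonOp w (fun y => g y (z y)) x -
      graphonOp w (fun y => g y (z' y)) x) ≤ _
    rw [normL2_congr (hw.op_sub (hmem z) (hmem z'))]
    calc _ ≤ graphonOpNorm w * normL2 (fun y => g y (z y) - g y (z' y)) := hw.normL2_op_le hsub
      _ ≤ graphonOpNorm w * (L * normL2 (fun y => z y - z' y) + 0 * normL2 (fun y => z y - z' y)) := by
          refine mul_le_mul_of_nonneg_left ?_ (graphonOpNorm_nonneg w)
          refine normL2_le_of_abs_le hL le_rfl hzz hzz ?_
          filter_upwards [hlip] with y hy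
          simpa using hy (z y) (z' y)
      _ = _ := by
          rw [← normL2_coe, normL2_congr (Lp.coeFn_sub z z')]
          change _ = graphonOpNorm w * L * normL2 (fun y => z y - z' y)
          ring
  refine ⟨ContractingWith.fixedPoint T hcontr, (hfix _).2 hcontr.fixedPoint_isFixedPt, ?_⟩
  intro z hz
  exact hcontr.fixedPoint_unique ((hfix z).1 hz)

/-! ### The equilibrium of the graphon game -/

theorem LipschitzDrift.continuous {A : Set ℝ} {b : ℝ → ℝ → ℝ} {cα cz : ℝ}
    (hb : LipschitzDrift A b cα cz) : Continuous (fun p : A × ℝ => b p.1 p.2) := by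
  refine continuous_iff_continuousAt.2 fun p => ?_
  rw [ContinuousAt, tendsto_iff_dist_tendsto_zero]
  have h : Tendsto (fun q : A × ℝ => √cα * |(q.1 : ℝ) - p.1| + √cz * |q.2 - p.2|) (𝓝 p)
      (𝓝 (√cα * |(p.1 : ℝ) - p.1| + √cz * |p.2 - p.2|)) :=
    Continuous.tendsto (by fun_prop) p
  simp only [sub_self, abs_zero, mul_zero, add_zero] at h
  exact squeeze_zero (fun _ => dist_nonneg)
    (fun q => hb.abs_sub_le q.1.2 p.1.2 q.2 p.2) h

/-- `b` is known to be continuous only on `A × ℝ`, so `α` is first modified on a null set to take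
all its values in `A`. -/
theorem LipschitzDrift.aestronglyMeasurable_comp {X : Type*} [MeasurableSpace X] {μ : Measure X}
    {A : Set ℝ} {b : ℝ → ℝ → ℝ} {cα cz : ℝ} (hb : LipschitzDrift A b cα cz)
    (hA : A.Nonempty) (hAc : IsClosed A) {α z : X → ℝ} (hα : AEStronglyMeasurable α μ)
    (hz : AEStronglyMeasurable z μ) (hαA : ∀ᵐ x ∂μ, α x ∈ A) :
    AEStronglyMeasurable (fun x => b (α x) (z x)) μ := by
  classical
  obtain ⟨a₀, ha₀⟩ := hA
  set α' : X → ℝ := fun x => if hα.mk α x ∈ A then hα.mk α x else a₀ with hα'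
  have hα'A : ∀ x, α' x ∈ A := fun x => by
    by_cases h : hα.mk α x ∈ A <;> simp [hα', h, ha₀]
  have hm : Measurable α' :=
    Measurable.ite (hα.stronglyMeasurable_mk.measurable hAc.measurableSet)
      hα.stronglyMeasurable_mk.measurable measurable_const
  have hcomp : Measurable (fun x => b (α' x) (hz.mk z x)) :=
    hb.continuous.measurable.comp
      ((hm.subtype_mk (h := hα'A)).prodMk hz.stronglyMeasurable_mk.measurable)
  refine ⟨_, hcomp.stronglyMeasurable, ?_⟩
  filter_upwards [hα.ae_eq_mk, hz.ae_eq_mk, hαA] with x h1 h2 h3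
  rw [h1] at h3
  simp [hα', h3, h1, ← h2]

theorem memLp_drift {X : Type*} [MeasurableSpace X] {μ : Measure X} [IsFiniteMeasure μ]
    {A : Set ℝ} {b : ℝ → ℝ → ℝ} {cα cz c₀ : ℝ} (hb : LipschitzDrift A b cα cz)
    (hb_bdd : BoundedDrift A b c₀) (hA : A.Nonempty) (hAc : IsClosed A) {α z : X → ℝ}
    (hα : AEStronglyMeasurable α μ) (hz : AEStronglyMeasurable z μ) (hαA : ∀ᵐ x ∂μ, α x ∈ A) :
    MemLp (fun x => b (α x) (z x)) 2 μ := by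
  refine MemLp.of_bound (hb.aestronglyMeasurable_comp hA hAc hα hz hαA) c₀ ?_
  filter_upwards [hαA] with x hx
  exact hb_bdd.2 _ hx _

theorem existsUnique_graphonAggregate {A : Set ℝ} {b : ℝ → ℝ → ℝ} {cα cz c₀ : ℝ}
    (hb : LipschitzDrift A b cα cz) (hb_bdd : BoundedDrift A b c₀) (hA : A.Nonempty)
    (hAc : IsClosed A) {w : I → I → ℝ} (hw : IsGraphon w) (hsmall : √cz * graphonOpNorm w < 1)
    {α : Lp ℝ 2 (volume : Measure I)} (hα : α ∈ Admissible A) :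
    ∃! z, IsGraphonAggregate b w α z := by
  refine hw.existsUnique_hammerstein (g := fun y s => b (α y) s) (Real.sqrt_nonneg cz)
    (by rwa [mul_comm]) (fun z => ?_) ?_
  · exact memLp_drift hb hb_bdd hA hAc (Lp.aestronglyMeasurable α) (Lp.aestronglyMeasurable z) hα
  · filter_upwards [show ∀ᵐ x, α x ∈ A from hα] with y hy s t
    exact hb.abs_sub_le_right hy s t

/-- If `a` is a Lipschitz selection of best replies, the graphon game has a unique equilibrium, it is
`a ∘ z` for the solution `z` of `z = 𝐖 b(a(z), z)`. -/
theorem existsUnique_graphonNash {A : Set ℝ} {b : ℝ → ℝ → ℝ} {f : ℝ → ℝ → ℝ → ℝ} {μ₀ : Measure ℝ}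
    {cα cz c₀ lc κ : ℝ} (hb : LipschitzDrift A b cα cz) (hb_bdd : BoundedDrift A b c₀)
    (hA : A.Nonempty) (hAc : IsClosed A) {w : I → I → ℝ} (hw : IsGraphon w) (hlc : 0 < lc)
    (hκ : 0 ≤ κ) {a : ℝ → ℝ} (haA : ∀ z, a z ∈ A)
    (hgrowth : ∀ z, ∀ β ∈ A, cost b f μ₀ (a z) z + lc / 2 * (β - a z) ^ 2 ≤ cost b f μ₀ β z)
    (halip : ∀ z z', |a z - a z'| ≤ κ * |z - z'|) (hsmall : √cz * graphonOpNorm w < 1)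
    (hcontr : graphonOpNorm w * (√cα * κ + √cz) < 1) :
    ∃ αhat z : Lp ℝ 2 (volume : Measure I), (αhat =ᵐ[volume] fun x => a (z x)) ∧
      (∀ᵐ x, z x = ∫ y, w x y * b (a (z y)) (z y)) ∧ IsGraphonNash A b f μ₀ w αhat ∧
      ∀ α, IsGraphonNash A b f μ₀ w α → α = αhat := by
  have hac : Continuous a := by
    refine (LipschitzWith.of_dist_le_mul (K := ⟨κ, hκ⟩) fun z z' => ?_).continuous
    exact halip z z'
  have ham : ∀ z : Lp ℝ 2 (volume : Measure I), AEStronglyMeasurable (fun x => a (z x)) volume :=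
    fun z => hac.comp_aestronglyMeasurable (Lp.aestronglyMeasurable z)
  obtain ⟨z, hz, hzuniq⟩ := hw.existsUnique_hammerstein (g := fun _ s => b (a s) s)
    (L := √cα * κ + √cz) (by positivity) hcontr
    (fun z => memLp_drift hb hb_bdd hA hAc (ham z) (Lp.aestronglyMeasurable z)
      (Eventually.of_forall fun _ => haA _))
    (Eventually.of_forall fun _ s t => by
      refine (hb.abs_sub_le (haA s) (haA t) s t).trans ?_
      have := mul_le_mul_of_nonneg_left (halip s t) (Real.sqrt_nonneg cα)
      linarith)
  have hamem : MemLp (fun x => a (z x)) 2 volume := by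
    have hconst : MemLp (fun _ : I => |a 0|) 2 volume := memLp_const _
    have habs : MemLp (fun x => κ * |z x|) 2 volume := (Lp.memLp z).abs.const_mul κ
    have hdom : MemLp (fun x => |a 0| + κ * |z x|) 2 volume := hconst.add habs
    refine hdom.of_le (ham z) (Eventually.of_forall fun x => ?_)
    have h1 := halip (z x) 0
    rw [sub_zero] at h1
    have h2 := abs_sub_abs_le_abs_sub (a (z x)) (a 0)
    simp only [Real.norm_eq_abs]
    exact le_trans (by linarith) (le_abs_self _)
  have hhat := hamem.coeFn_toLp
  set αhat : Lp ℝ 2 (volume : Measure I) := hamem.toLp _ with hαhat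
  have hadm : αhat ∈ Admissible A := by
    filter_upwards [hhat] with x hx
    rw [hx]
    exact haA _
  -- Uniqueness of the aggregate identifies the `Classical.epsilon` choice with `z`.
  have hagg : graphonAggregate b w αhat = z := by
    have hex := existsUnique_graphonAggregate hb hb_bdd hA hAc hw hsmall hadm
    refine hex.unique (Classical.epsilon_spec hex.exists) ?_
    filter_upwards [hz] with x hx
    rw [hx]
    refine integral_congr_ae ?_
    filter_upwards [hhat] with y hy
    rw [hy]
  refine ⟨αhat, z, hhat, hz, ⟨hadm, hadm, ?_⟩, ?_⟩
  · filter_upwards [hhat] with x hx β hβ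
    rw [hx, hagg]
    have := hgrowth (z x) β hβ
    have h0 : 0 ≤ lc / 2 * (β - a (z x)) ^ 2 := by positivity
    linarith
  · rintro α ⟨hαadm, -, hαmin⟩
    have hex := existsUnique_graphonAggregate hb hb_bdd hA hAc hw hsmall hαadm
    have hspec : IsGraphonAggregate b w α (graphonAggregate b w α) :=
      Classical.epsilon_spec hex.exists
    set z' := graphonAggregate b w α
    -- Quadratic growth excludes any minimizer other than `a (z' x)`; hence `z'` solves the same
    -- fixed point equation as `z`.
    have hαeq : ∀ᵐ x, α x = a (z' x) := by
      filter_upwards [hαmin, show ∀ᵐ x, α x ∈ A from hαadm] with x hx hxA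
      have h1 := hx _ (haA (z' x))
      have h2 := hgrowth (z' x) _ hxA
      have h3 : lc / 2 * (α x - a (z' x)) ^ 2 ≤ 0 := by linarith
      have h4 : (α x - a (z' x)) ^ 2 ≤ 0 := by
        by_contra! hcon
        have : 0 < lc / 2 * (α x - a (z' x)) ^ 2 := by positivity
        linarith
      exact sub_eq_zero.1 (pow_eq_zero_iff two_ne_zero |>.1 (le_antisymm h4 (sq_nonneg _)))
    have hz' : z' = z := by
      refine hzuniq z' ?_
      filter_upwards [hspec] with x hx
      rw [hx]
      refine integral_congr_ae ?_
      filter_upwards [hαeq] with y hy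
      rw [hy]
    refine Lp.ext ?_
    filter_upwards [hαeq, hhat] with x h1 h2
    rw [h1, hz', h2]

/-! ### Cut convergence with convergence of norms is `L²` convergence -/

/-- Replacing `g` by a nearby `g'` changes the inner products by at most `M * ‖g - g'‖`, uniformly
in `n`. Weak convergence of a bounded sequence can thus be tested on a dense class. -/
theorem isClosed_tendsto_inner {H : Type*} [NormedAddCommGroup H] [InnerProductSpace ℝ H]
    {u : ℕ → H} {M : ℝ} (hM : ∀ᶠ n in atTop, ‖u n‖ ≤ M) :
    IsClosed {g : H | Tendsto (fun n => inner ℝ g (u n)) atTop (𝓝 0)} := by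
  refine isClosed_of_closure_subset fun g hg => ?_
  have hM0 : 0 ≤ M := by
    obtain ⟨n, hn⟩ := hM.exists
    exact (norm_nonneg _).trans hn
  rw [Set.mem_ofPred_eq, Metric.tendsto_atTop']
  intro ε hε
  obtain ⟨g', hg', hdist⟩ := Metric.mem_closure_iff.1 hg (ε / (2 * (M + 1))) (by positivity)
  have h1 := (Metric.tendsto_nhds.1 hg') (ε / 2) (by positivity)
  obtain ⟨n₀, hn₀⟩ := eventually_atTop.1 (h1.and hM)
  refine ⟨n₀, fun n hn => ?_⟩
  obtain ⟨h2, h3⟩ := hn₀ n hn.le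
  rw [Real.dist_eq, sub_zero] at h2 ⊢
  rw [dist_eq_norm] at hdist
  have h4 : inner ℝ g (u n) = inner ℝ (g - g') (u n) + inner ℝ g' (u n) := by
    rw [inner_sub_left]; ring
  have h5 : |inner ℝ (g - g') (u n)| ≤ ε / (2 * (M + 1)) * M :=
    (abs_real_inner_le_norm _ _).trans
      (mul_le_mul hdist.le h3 (norm_nonneg _) (by positivity))
  have h6 : ε / (2 * (M + 1)) * M ≤ ε / 2 := by
    rw [div_mul_eq_mul_div, div_le_div_iff₀ (by positivity) (by positivity)]
    nlinarith
  rw [h4]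
  linarith [abs_add_le (inner ℝ (g - g') (u n)) (inner ℝ g' (u n))]

/-- A bounded sequence in `L²` of the square whose integrals over rectangles tend to zero converges
weakly to zero. -/
theorem tendsto_inner_of_tendsto_rectangles {u : ℕ → Lp ℝ 2 (volume : Measure (I × I))} {M : ℝ}
    (hM : ∀ᶠ n in atTop, ‖u n‖ ≤ M)
    (hrect : ∀ S T : Set I, MeasurableSet S → MeasurableSet T →
      Tendsto (fun n => ∫ p in S ×ˢ T, u n p) atTop (𝓝 0))
    (g : Lp ℝ 2 (volume : Measure (I × I))) :
    Tendsto (fun n => inner ℝ g (u n)) atTop (𝓝 0) := by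
  have hclosed := isClosed_tendsto_inner hM
  have h_int : ∀ n, Integrable (u n) volume := fun n => (Lp.memLp (u n)).integrable one_le_two
  -- A π-λ argument: the rectangles form a π-system generating the product σ-algebra, and
  -- complements are taken in the full square, itself a rectangle.
  have hsets : ∀ s : Set (I × I), MeasurableSet s →
      Tendsto (fun n => ∫ p in s, u n p) atTop (𝓝 0) := by
    intro s hs
    induction s, hs using MeasurableSpace.induction_on_inter generateFrom_prod.symm
      isPiSystem_prod with
    | empty => simp
    | basic t ht =>
      obtain ⟨S, hS, T, hT, rfl⟩ := ht
      exact hrect S T hS hT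
    | compl t htm ih =>
      have h1 := hrect Set.univ Set.univ .univ .univ
      simp only [Set.univ_prod_univ, setIntegral_univ] at h1
      have h2 := h1.sub ih
      rw [sub_zero] at h2
      refine h2.congr fun n => ?_
      rw [← integral_add_compl htm (h_int n)]
      ring
    -- The indicator of a disjoint union is the `L²` limit of the indicators of its finite partial
    -- unions, so closedness of the set of good test functions applies.
    | iUnion t hdisj htm ih =>
      have hacc : ∀ n, MeasurableSet (Set.accumulate t n) := fun n =>
        MeasurableSet.biUnion (Set.to_countable _) fun i _ => htm i
      have hU : MeasurableSet (⋃ i, t i) := MeasurableSet.iUnion htm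
      have hmem : ∀ m, indicatorConstLp 2 (hacc m) (measure_ne_top volume _) (1 : ℝ) ∈
          {g : Lp ℝ 2 (volume : Measure (I × I)) |
            Tendsto (fun n => inner ℝ g (u n)) atTop (𝓝 0)} := by
        intro m
        simp only [Set.mem_ofPred_eq, L2.inner_indicatorConstLp_one]
        have hsum : ∀ n, ∫ p in Set.accumulate t m, u n p =
            ∑ i ∈ Finset.range (m + 1), ∫ p in t i, u n p := by
          intro n
          rw [← integral_biUnion_finset _ (fun i _ => htm i) (fun i _ j _ hij => hdisj hij)
            (fun i _ => (h_int n).integrableOn)]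
          congr 2
          ext p
          simp [Set.accumulate]
        simp only [hsum]
        rw [show (0 : ℝ) = ∑ i ∈ Finset.range (m + 1), (0 : ℝ) by simp]
        exact tendsto_finsetSum _ fun i _ => ih i
      have hlim : Tendsto (fun m => indicatorConstLp 2 (hacc m) (measure_ne_top volume _) (1 : ℝ))
          atTop (𝓝 (indicatorConstLp 2 hU (measure_ne_top volume _) (1 : ℝ))) := by
        refine tendsto_indicatorConstLp_set (by simp) ?_
        have hsub : ∀ m, Set.accumulate t m ⊆ ⋃ i, t i := fun m => by
          rw [← Set.iUnion_accumulate]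
          exact Set.subset_iUnion _ m
        have h1 : ∀ m, (volume : Measure (I × I)) (symmDiff (Set.accumulate t m) (⋃ i, t i)) =
            volume (⋃ i, t i) - volume (Set.accumulate t m) := fun m => by
          rw [Set.symmDiff_def, Set.sdiff_eq_empty.2 (hsub m), Set.empty_union,
            measure_sdiff (hsub m) (hacc m).nullMeasurableSet (measure_ne_top _ _)]
        simp only [h1]
        have h2 := ENNReal.Tendsto.sub (tendsto_const_nhds (x := volume (⋃ i, t i)))
          (tendsto_measure_iUnion_accumulate (μ := (volume : Measure (I × I))) (f := t))
          (Or.inl (measure_ne_top _ _))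
        rwa [tsub_self] at h2
      have := hclosed.mem_of_tendsto hlim (Eventually.of_forall hmem)
      simpa only [Set.mem_ofPred_eq, L2.inner_indicatorConstLp_one] using this
  refine Lp.induction (p := 2) ENNReal.ofNat_ne_top
    (fun g : Lp ℝ 2 (volume : Measure (I × I)) => Tendsto (fun n => inner ℝ g (u n)) atTop (𝓝 0))
    (fun c s hs hμs => ?_) (fun f g hf hg _ ihf ihg => ?_) hclosed g
  · rw [Lp.simpleFunc.coe_indicatorConst]
    simp only [L2.inner_indicatorConstLp_eq_inner_setIntegral ℝ]
    have := (hsets _ hs).mul_const c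
    rw [zero_mul] at this
    simpa using this
  · simp only [inner_add_left]
    simpa using ihf.add ihg

theorem IsGraphon.abs_setIntegral_le_cutNorm {u : I → I → ℝ} (hu : IsGraphon u) {S T : Set I}
    (hS : MeasurableSet S) (hT : MeasurableSet T) :
    |∫ p in S ×ˢ T, u p.1 p.2| ≤ cutNorm u := by
  refine le_csSup ⟨∫ p : I × I, |u p.1 p.2|, ?_⟩ ⟨S, T, hS, hT, rfl⟩
  rintro r ⟨S, T, -, -, rfl⟩
  have h_int : Integrable (fun p : I × I => |u p.1 p.2|) := (hu.memLp.integrable one_le_two).abs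
  exact abs_integral_le_integral_abs.trans
    (setIntegral_le_integral h_int (Eventually.of_forall fun _ => abs_nonneg _))

theorem graphonNorm_eq_norm_toLp {w : I → I → ℝ} (hw : IsGraphon w) :
    graphonNorm w = ‖hw.memLp.toLp _‖ := by
  rw [graphonNorm, ← norm_toLp_sq hw.memLp, Real.sqrt_sq (norm_nonneg _)]

/-- The Radon–Riesz property of Hilbert spaces. The cut norm dominates all integrals over
rectangles, so it gives weak convergence; expanding `‖G n - F‖²` then leaves only the difference of
squared norms and a vanishing inner product. -/
theorem tendsto_graphonNorm_sub {w : I → I → ℝ} (hw : IsGraphon w) {v : ℕ → I → I → ℝ}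
    (hv : ∀ n, IsGraphon (v n))
    (hcut : Tendsto (fun n => cutNorm (fun x y => v n x y - w x y)) atTop (𝓝 0))
    (hnorm : Tendsto (fun n => graphonNorm (v n)) atTop (𝓝 (graphonNorm w))) :
    Tendsto (fun n => graphonNorm (fun x y => v n x y - w x y)) atTop (𝓝 0) := by
  set F := hw.memLp.toLp _ with hF
  set G : ℕ → Lp ℝ 2 (volume : Measure (I × I)) := fun n => (hv n).memLp.toLp _ with hG
  have hsub : ∀ n, ((hv n).sub hw).memLp.toLp _ = G n - F := fun n => by
    rw [hG, hF, ← MemLp.toLp_sub]; rfl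
  have hnormG : Tendsto (fun n => ‖G n‖) atTop (𝓝 ‖F‖) := by
    simpa only [graphonNorm_eq_norm_toLp hw, graphonNorm_eq_norm_toLp (hv _)] using hnorm
  have hweak : Tendsto (fun n => inner ℝ F (G n - F)) atTop (𝓝 0) := by
    refine tendsto_inner_of_tendsto_rectangles (M := ‖F‖ + 1 + ‖F‖) ?_ ?_ F
    · filter_upwards [hnormG.eventually_le_const (lt_add_one ‖F‖)] with n hn
      exact (norm_sub_le _ _).trans (by linarith)
    · intro S T hS hT
      refine squeeze_zero_norm (fun n => ?_) hcut
      rw [← hsub n, Real.norm_eq_abs]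
      refine le_of_eq_of_le ?_ (((hv n).sub hw).abs_setIntegral_le_cutNorm hS hT)
      congr 1
      exact integral_congr_ae (ae_restrict_of_ae ((hv n).sub hw).memLp.coeFn_toLp)
  have hsq : Tendsto (fun n => ‖G n - F‖ ^ 2) atTop (𝓝 0) := by
    have h1 : ∀ n, ‖G n - F‖ ^ 2 = ‖G n‖ ^ 2 - ‖F‖ ^ 2 - 2 * inner ℝ F (G n - F) := fun n => by
      rw [norm_sub_sq_real, inner_sub_right, real_inner_self_eq_norm_sq, real_inner_comm]
      ring
    simp only [h1]
    have h2 := ((hnormG.pow 2).sub_const (‖F‖ ^ 2)).sub (hweak.const_mul 2)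
    simpa using h2
  have hsqrt := hsq.sqrt
  simp only [Real.sqrt_sq (norm_nonneg _), Real.sqrt_zero] at hsqrt
  refine hsqrt.congr fun n => ?_
  rw [graphonNorm_eq_norm_toLp ((hv n).sub hw), hsub n]

/-! ### Relabelling -/

theorem MPEquiv.measurePreserving_prodMap (φ : MPEquiv) :
    MeasurePreserving (Prod.map φ.1 φ.1) (volume : Measure (I × I)) volume := by
  rw [Measure.volume_eq_prod]
  exact φ.2.prod φ.2

theorem IsGraphon.comp {w : I → I → ℝ} (hw : IsGraphon w) (φ : MPEquiv) :
    IsGraphon (fun x y => w (φ.1 x) (φ.1 y)) where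
  symm _ _ := hw.symm _ _
  measurable := hw.measurable.comp φ.measurePreserving_prodMap.measurable
  integrable_sq := (φ.measurePreserving_prodMap.integrable_comp
    hw.integrable_sq.aestronglyMeasurable).2 hw.integrable_sq

theorem graphonNorm_comp (w : I → I → ℝ) (φ : MPEquiv) :
    graphonNorm (fun x y => w (φ.1 x) (φ.1 y)) = graphonNorm w := by
  rw [graphonNorm, graphonNorm]
  congr 1
  exact φ.measurePreserving_prodMap.integral_comp
    (φ.1.prodCongr φ.1).measurableEmbedding (fun p : I × I => w p.1 p.2 ^ 2)

theorem graphonOp_comp (w : I → I → ℝ) (φ : MPEquiv) (u : I → ℝ) (x : I) :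
    graphonOp (fun x y => w (φ.1 x) (φ.1 y)) (fun y => u (φ.1 y)) x = graphonOp w u (φ.1 x) :=
  φ.2.integral_comp φ.1.measurableEmbedding (fun y => w (φ.1 x) y * u y)

instance : Nonempty MPEquiv := ⟨⟨MeasurableEquiv.refl I, MeasurePreserving.id volume⟩⟩

/-- Choose relabellings within `1 / (n + 1)` of the infimum in the cut distance. They preserve the
`L²` norm, so Radon–Riesz applies to the relabelled graphons. -/
theorem exists_relabelling {w : I → I → ℝ} (hw : IsGraphon w) {v : ℕ → I → I → ℝ}
    (hv : ∀ n, IsGraphon (v n)) (hcut : Tendsto (fun n => cutDist (v n) w) atTop (𝓝 0))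
    (hnorm : Tendsto (fun n => graphonNorm (v n)) atTop (𝓝 (graphonNorm w))) :
    ∃ φ : ℕ → MPEquiv, Tendsto
      (fun n => graphonNorm (fun x y => v n ((φ n).1 x) ((φ n).1 y) - w x y)) atTop (𝓝 0) := by
  have hex : ∀ n : ℕ, ∃ φ : MPEquiv, cutNorm (fun x y => v n (φ.1 x) (φ.1 y) - w x y) <
      cutDist (v n) w + 1 / ((n : ℝ) + 1) := fun n =>
    exists_lt_of_ciInf_lt (lt_add_of_pos_right _ Nat.one_div_pos_of_nat)
  choose φ hφ using hex
  refine ⟨φ, tendsto_graphonNorm_sub hw (fun n => (hv n).comp (φ n)) ?_ ?_⟩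
  · refine squeeze_zero (fun n => ?_) (fun n => (hφ n).le) ?_
    · refine Real.sSup_nonneg ?_
      rintro r ⟨S, T, -, -, rfl⟩
      exact abs_nonneg _
    · simpa using hcut.add tendsto_one_div_add_atTop_nhds_zero_nat
  · simpa only [graphonNorm_comp] using hnorm

/-! ### Linear interaction through a matrix -/

section Interaction

variable {N : ℕ} {E : Type*} [NormedAddCommGroup E] [NormedSpace ℝ E]

/-- The normalized squared Frobenius norm `(1/N²) ∑ W_{ij}²`. -/
noncomputable def frobeniusSq (W : Matrix (Fin N) (Fin N) ℝ) : ℝ :=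
  (∑ i, ∑ j, W i j ^ 2) / (N : ℝ) ^ 2

theorem frobeniusSq_nonneg (W : Matrix (Fin N) (Fin N) ℝ) : 0 ≤ frobeniusSq W :=
  div_nonneg (Finset.sum_nonneg fun _ _ => Finset.sum_nonneg fun _ _ => sq_nonneg _) (sq_nonneg _)

/-- Cauchy–Schwarz in each row: the finite analogue of the Hilbert–Schmidt bound. -/
theorem norm_interaction_sq_le (W : Matrix (Fin N) (Fin N) ℝ) (u : Fin N → E) :
    ∑ i, ‖(1 / (N : ℝ)) • ∑ j, W i j • u j‖ ^ 2 ≤ frobeniusSq W * ∑ j, ‖u j‖ ^ 2 := by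
  have h : ∀ i, ‖(1 / (N : ℝ)) • ∑ j, W i j • u j‖ ^ 2 ≤
      (1 / (N : ℝ) ^ 2) * ((∑ j, W i j ^ 2) * ∑ j, ‖u j‖ ^ 2) := fun i => by
    rw [norm_smul, mul_pow, Real.norm_eq_abs, sq_abs, div_pow, one_pow]
    refine mul_le_mul_of_nonneg_left ?_ (by positivity)
    have h1 : ‖∑ j, W i j • u j‖ ≤ ∑ j, |W i j| * ‖u j‖ :=
      (norm_sum_le _ _).trans_eq (Finset.sum_congr rfl fun j _ => by
        rw [norm_smul, Real.norm_eq_abs])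
    have h2 := Finset.sum_mul_sq_le_sq_mul_sq Finset.univ (fun j => |W i j|) (fun j => ‖u j‖)
    simp only [sq_abs] at h2
    exact (pow_le_pow_left₀ (norm_nonneg _) h1 2).trans h2
  refine (Finset.sum_le_sum fun i _ => h i).trans_eq ?_
  rw [← Finset.mul_sum, ← Finset.sum_mul, frobeniusSq]
  ring

/-- The system is a contraction on the `ℓ²` product of copies of `E`. It is applied with `E = L²(Ω)`
for the random aggregates and with `E = ℝ` for the deterministic ones. -/
theorem exists_interaction_fixedPoint [CompleteSpace E] (W : Matrix (Fin N) (Fin N) ℝ)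
    {G : Fin N → E → E} {K : ℝ} (hK : 0 ≤ K) (hG : ∀ j x y, ‖G j x - G j y‖ ≤ K * ‖x - y‖)
    (hsmall : K ^ 2 * frobeniusSq W < 1) :
    ∃ z : Fin N → E, ∀ i, z i = (1 / (N : ℝ)) • ∑ j, W i j • G j (z j) := by
  set T : PiLp 2 (fun _ : Fin N => E) → PiLp 2 (fun _ : Fin N => E) := fun z =>
    WithLp.toLp 2 (fun i => (1 / (N : ℝ)) • ∑ j, W i j • G j (z j)) with hT
  have hF := frobeniusSq_nonneg W
  have hlt : K * √(frobeniusSq W) < 1 := by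
    refine lt_of_pow_lt_pow_left₀ 2 zero_le_one ?_
    rw [mul_pow, Real.sq_sqrt hF, one_pow]
    exact hsmall
  have hcontr : ContractingWith ⟨K * √(frobeniusSq W), by positivity⟩ T := by
    refine ⟨by exact_mod_cast hlt, LipschitzWith.of_dist_le_mul fun z z' => ?_⟩
    rw [dist_eq_norm, dist_eq_norm]
    change ‖T z - T z'‖ ≤ K * √(frobeniusSq W) * ‖z - z'‖
    refine abs_le_of_sq_le_sq' ?_ (by positivity) |>.2
    rw [mul_pow, mul_pow, Real.sq_sqrt hF, PiLp.norm_sq_eq_of_L2, PiLp.norm_sq_eq_of_L2]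
    have h1 : ∀ i, (T z - T z') i = (1 / (N : ℝ)) • ∑ j, W i j • (G j (z j) - G j (z' j)) := by
      intro i
      simp only [hT, PiLp.sub_apply, smul_sub, Finset.sum_sub_distrib]
    simp only [h1]
    refine (norm_interaction_sq_le W _).trans ?_
    rw [mul_comm (K ^ 2), mul_assoc, Finset.mul_sum Finset.univ _ (K ^ 2)]
    refine mul_le_mul_of_nonneg_left (Finset.sum_le_sum fun j _ => ?_) hF
    rw [← mul_pow]
    exact pow_le_pow_left₀ (norm_nonneg _) (hG j _ _) 2
  refine ⟨(ContractingWith.fixedPoint T hcontr).ofLp, fun i => ?_⟩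
  have h := hcontr.fixedPoint_isFixedPt
  exact (congrArg (fun z : PiLp 2 (fun _ : Fin N => E) => z i) h).symm

/-- Stability of the interaction system under a perturbation `e`. -/
theorem interaction_stability (W : Matrix (Fin N) (Fin N) ℝ) {d u e : Fin N → E} {c ρ : ℝ}
    (hd : ∀ i, d i = (1 / (N : ℝ)) • ∑ j, W i j • u j + e i)
    (hu : ∀ j, ‖u j‖ ≤ √c * ‖d j‖) (hc : 0 ≤ c) (hρ : 2 * c * frobeniusSq W ≤ ρ) (hρ1 : ρ < 1) :
    ∑ i, ‖d i‖ ^ 2 ≤ 2 / (1 - ρ) * ∑ i, ‖e i‖ ^ 2 := by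
  -- The inequality `(x + y)² ≤ 2x² + 2y²` is the source of the factor `2` in the hypothesis `√(2 *
  -- cz) * ‖w‖₂ < 1`. The first term is later absorbed, leaving the factor `1 - ρ`.
  have h1 : ∀ i, ‖d i‖ ^ 2 ≤ 2 * ‖(1 / (N : ℝ)) • ∑ j, W i j • u j‖ ^ 2 + 2 * ‖e i‖ ^ 2 := by
    intro i
    have h2 := norm_add_le ((1 / (N : ℝ)) • ∑ j, W i j • u j) (e i)
    rw [← hd i] at h2
    have h3 := pow_le_pow_left₀ (norm_nonneg _) h2 2
    nlinarith [sq_nonneg (‖(1 / (N : ℝ)) • ∑ j, W i j • u j‖ - ‖e i‖)]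
  have h4 := Finset.sum_le_sum fun i (_ : i ∈ Finset.univ) => h1 i
  rw [Finset.sum_add_distrib, ← Finset.mul_sum, ← Finset.mul_sum] at h4
  have h5 : ∑ j, ‖u j‖ ^ 2 ≤ c * ∑ j, ‖d j‖ ^ 2 := by
    rw [Finset.mul_sum]
    refine Finset.sum_le_sum fun j _ => ?_
    have := pow_le_pow_left₀ (norm_nonneg _) (hu j) 2
    rwa [mul_pow, Real.sq_sqrt hc] at this
  have h6 := norm_interaction_sq_le W u
  have h7 := mul_le_mul_of_nonneg_left h5 (frobeniusSq_nonneg W)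
  have hS : 0 ≤ ∑ j, ‖d j‖ ^ 2 := Finset.sum_nonneg fun _ _ => sq_nonneg _
  have h8 := mul_le_mul_of_nonneg_right hρ hS
  have hρ' : 0 < 1 - ρ := by linarith
  rw [div_mul_eq_mul_div, le_div_iff₀ hρ']
  nlinarith

end Interaction

theorem sum_norm_le_sqrt {N : ℕ} {E : Type*} [SeminormedAddCommGroup E] (d : Fin N → E) :
    ∑ i, ‖d i‖ ≤ √(N * ∑ i, ‖d i‖ ^ 2) := by
  refine Real.le_sqrt_of_sq_le ?_
  simpa using sq_sum_le_card_mul_sum_sq (s := Finset.univ) (f := fun i => ‖d i‖)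

/-! ### Comparison of costs through couplings -/

section Coupling

variable {Ω : Type*} [MeasurableSpace Ω] {P : Measure Ω}
  {μ₀ : Measure ℝ} {ξ : Ω → ℝ}

/-- Couple the two laws by using the same shock `ξ` in both; the shock then contributes nothing to
the transport cost. -/
theorem wasserstein2_law_le (hξ : HasLaw ξ μ₀ P) (x y : Lp ℝ 2 P) :
    wasserstein2 (P.map fun ω => (ξ ω, x ω)) (P.map fun ω => (ξ ω, y ω)) ≤ ‖x - y‖ := by
  have hx : AEMeasurable x P := (Lp.aestronglyMeasurable x).aemeasurable
  have hy : AEMeasurable y P := (Lp.aestronglyMeasurable y).aemeasurable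
  have hmx : AEMeasurable (fun ω => (ξ ω, x ω)) P := hξ.aemeasurable.prodMk hx
  have hmy : AEMeasurable (fun ω => (ξ ω, y ω)) P := hξ.aemeasurable.prodMk hy
  have hm := hmx.prodMk hmy
  have hnorm : ‖x - y‖ ^ 2 = ∫ ω, (x ω - y ω) ^ 2 ∂P := by
    rw [norm_Lp_sq]
    refine integral_congr_ae ?_
    filter_upwards [Lp.coeFn_sub x y] with ω hω
    rw [hω]
    rfl
  have hlint : ∫⁻ q, ENNReal.ofReal ((q.1.1 - q.2.1) ^ 2 + (q.1.2 - q.2.2) ^ 2)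
      ∂(P.map fun ω => ((ξ ω, x ω), (ξ ω, y ω))) = ENNReal.ofReal (‖x - y‖ ^ 2) := by
    have h_int : Integrable (fun ω => (x ω - y ω) ^ 2) P :=
      ((Lp.memLp x).sub (Lp.memLp y)).integrable_sq
    rw [lintegral_map' (by fun_prop) hm, hnorm, ofReal_integral_eq_lintegral_ofReal h_int
      (Eventually.of_forall fun _ => sq_nonneg _)]
    simp
  rw [wasserstein2]
  refine Real.sqrt_le_iff.2 ⟨norm_nonneg _, ?_⟩
  refine ENNReal.toReal_le_of_le_ofReal (sq_nonneg _) ?_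
  rw [← hlint]
  refine iInf₂_le _ ⟨?_, ?_⟩
  · rw [AEMeasurable.map_map_of_aemeasurable measurable_fst.aemeasurable hm]
    rfl
  · rw [AEMeasurable.map_map_of_aemeasurable measurable_snd.aemeasurable hm]
    rfl

variable [IsProbabilityMeasure P]

theorem law_mem_shockAggregateLaws (hξ : HasLaw ξ μ₀ P) (x : Lp ℝ 2 P) :
    P.map (fun ω => (ξ ω, x ω)) ∈ ShockAggregateLaws μ₀ := by
  have hx : AEMeasurable x P := (Lp.aestronglyMeasurable x).aemeasurable
  have hm : AEMeasurable (fun ω => (ξ ω, x ω)) P := hξ.aemeasurable.prodMk hx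
  refine ⟨Measure.isProbabilityMeasure_map hm, ?_, ?_⟩
  · rw [AEMeasurable.map_map_of_aemeasurable measurable_fst.aemeasurable hm, ← hξ.map_eq]
    rfl
  · rw [memLp_map_measure_iff measurable_snd.aestronglyMeasurable hm]
    exact Lp.memLp x

theorem costLaw_law {A : Set ℝ} {b : ℝ → ℝ → ℝ} {f : ℝ → ℝ → ℝ → ℝ}
    (hf : CostIntegrable A b f μ₀) (hξ : HasLaw ξ μ₀ P) {α : ℝ} (hα : α ∈ A) (x : Lp ℝ 2 P) :
    costLaw b f α (P.map fun ω => (ξ ω, x ω)) = ∫ ω, f (b α (x ω) + ξ ω) α (x ω) ∂P := by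
  rw [costLaw, integral_map
    (hξ.aemeasurable.prodMk (Lp.aestronglyMeasurable x).aemeasurable)
    (hf α hα _ (law_mem_shockAggregateLaws hξ x)).aestronglyMeasurable]

/-- The Lipschitz hypothesis on laws, read through the common-shock coupling. `|lJt|` appears
because `lJt` carries no sign assumption. -/
theorem abs_expectedCost_sub_le {A : Set ℝ} {b : ℝ → ℝ → ℝ} {f : ℝ → ℝ → ℝ → ℝ} {lJt : ℝ}
    (hf : CostIntegrable A b f μ₀) (hJt : CostLawLipschitz A b f μ₀ lJt) (hξ : HasLaw ξ μ₀ P)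
    {α : ℝ} (hα : α ∈ A) (x y : Lp ℝ 2 P) :
    |(∫ ω, f (b α (y ω) + ξ ω) α (y ω) ∂P) - ∫ ω, f (b α (x ω) + ξ ω) α (x ω) ∂P| ≤
      |lJt| * ‖x - y‖ := by
  rw [← costLaw_law hf hξ hα x, ← costLaw_law hf hξ hα y]
  refine (hJt α hα _ (law_mem_shockAggregateLaws hξ x) _
    (law_mem_shockAggregateLaws hξ y)).trans ?_
  exact mul_le_mul (le_abs_self _) (wasserstein2_law_le hξ x y) (Real.sqrt_nonneg _)
    (abs_nonneg _)

/-- A deterministic aggregate is a constant element of `L²(Ω)`. This puts the limiting cost and the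
finite-player cost in the same framework, so they can be compared. -/
theorem cost_eq_expectedCost_const {A : Set ℝ} {b : ℝ → ℝ → ℝ} {f : ℝ → ℝ → ℝ → ℝ}
    (hf : CostIntegrable A b f μ₀) (hξ : HasLaw ξ μ₀ P) {α : ℝ} (hα : α ∈ A) (c : ℝ) :
    cost b f μ₀ α c = ∫ ω, f (b α (Lp.const 2 P c ω) + ξ ω) α (Lp.const 2 P c ω) ∂P := by
  have hlaw : (P.map fun ω => (ξ ω, Lp.const 2 P c ω)) = μ₀.map fun t => (t, c) := by
    rw [← hξ.map_eq, AEMeasurable.map_map_of_aemeasurable (by fun_prop) hξ.aemeasurable]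
    exact Measure.map_congr (Eventually.of_forall fun ω => by simp)
  have hmem := law_mem_shockAggregateLaws hξ (Lp.const 2 P c)
  rw [← costLaw_law hf hξ hα, hlaw, costLaw, integral_map (by fun_prop)
    (hlaw ▸ (hf α hα _ hmem).aestronglyMeasurable)]
  rfl

end Coupling

/-! ### Approximate equilibrium property of the finite-player equilibria -/

section FinitePlayer

variable {Ω : Type*} [MeasurableSpace Ω] {P : Measure Ω}
  {A : Set ℝ} {b : ℝ → ℝ → ℝ} {cα cz c₀ : ℝ}

theorem Lp_norm_le_of_bound [IsProbabilityMeasure P] {x : Lp ℝ 2 P} {c : ℝ} (hc : 0 ≤ c)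
    (h : ∀ᵐ ω ∂P, |x ω| ≤ c) :
    ‖x‖ ≤ c := by
  have := Lp.norm_le_of_ae_bound (f := x) hc h
  have hP : measureUnivNNReal P = 1 := by simp [measureUnivNNReal]
  simpa [hP] using this

/-- The drift as a map on `L²(Ω)`. -/
theorem exists_driftLp (P : Measure Ω) [IsProbabilityMeasure P] (hb : LipschitzDrift A b cα cz)
    (hb_bdd : BoundedDrift A b c₀) (hA : A.Nonempty) (hAc : IsClosed A) :
    ∃ G : ℝ → Lp ℝ 2 P → Lp ℝ 2 P,
      (∀ α ∈ A, ∀ x, (G α x : Ω → ℝ) =ᵐ[P] fun ω => b α (x ω)) ∧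
      (∀ α ∈ A, ∀ x y, ‖G α x - G α y‖ ≤ √cz * ‖x - y‖) ∧
      ∀ α ∈ A, ∀ α' ∈ A, ∀ x y, ‖G α x - G α' y‖ ≤ 2 * c₀ := by
  have hmem : ∀ α ∈ A, ∀ x : Lp ℝ 2 P, MemLp (fun ω => b α (x ω)) 2 P := fun α hα x =>
    memLp_drift hb hb_bdd hA hAc aestronglyMeasurable_const (Lp.aestronglyMeasurable x)
      (Eventually.of_forall fun _ => hα)
  choose! G hG using fun α (hα : α ∈ A) (x : Lp ℝ 2 P) =>
    (⟨(hmem α hα x).toLp _, (hmem α hα x).coeFn_toLp⟩ :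
      ∃ y : Lp ℝ 2 P, (y : Ω → ℝ) =ᵐ[P] fun ω => b α (x ω))
  refine ⟨G, hG, fun α hα x y => ?_, fun α hα α' hα' x y => ?_⟩
  · refine Lp.norm_le_mul_norm_of_ae_le_mul ?_
    filter_upwards [hG α hα x, hG α hα y, Lp.coeFn_sub (G α x) (G α y), Lp.coeFn_sub x y] with
      ω h1 h2 h3 h4
    rw [h3, h4, Pi.sub_apply, Pi.sub_apply, h1, h2]
    exact hb.abs_sub_le_right hα _ _
  · refine Lp_norm_le_of_bound (by linarith [hb_bdd.1]) ?_
    filter_upwards [hG α hα x, hG α' hα' y, Lp.coeFn_sub (G α x) (G α' y)] with ω h1 h2 h3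
    rw [h3, Pi.sub_apply, h1, h2]
    have h4 := hb_bdd.2 α hα (x ω)
    have h5 := hb_bdd.2 α' hα' (y ω)
    exact (abs_sub _ _).trans (by linarith)

variable {N : ℕ} {ξ : Fin N → Ω → ℝ} {W : Matrix (Fin N) (Fin N) ℝ}

/-- Turns the almost sure system into an equation in the Hilbert space `L²(Ω)`, where the
contraction and stability estimates live. -/
theorem isAggregate_iff {G : ℝ → Lp ℝ 2 P → Lp ℝ 2 P}
    (hG : ∀ α ∈ A, ∀ x, (G α x : Ω → ℝ) =ᵐ[P] fun ω => b α (x ω)) {X : Fin N → Lp ℝ 2 P}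
    (hX : ∀ j, (X j : Ω → ℝ) =ᵐ[P] ξ j) {α : Fin N → ℝ} (hα : ∀ j, α j ∈ A)
    (z : Fin N → Lp ℝ 2 P) :
    IsAggregate b P ξ W α z ↔
      ∀ i, z i = (1 / (N : ℝ)) • ∑ j, W i j • (G (α j) (z j) + X j) := by
  have key : ∀ i, (((1 / (N : ℝ)) • ∑ j, W i j • (G (α j) (z j) + X j) : Lp ℝ 2 P) : Ω → ℝ)
      =ᵐ[P] fun ω => (1 / (N : ℝ)) * ∑ j, W i j * (b (α j) (z j ω) + ξ j ω) := by
    intro i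
    have h1 : ∀ᵐ ω ∂P, ∀ j, (W i j • (G (α j) (z j) + X j) : Lp ℝ 2 P) ω =
        W i j * (b (α j) (z j ω) + ξ j ω) := by
      refine ae_all_iff.2 fun j => ?_
      filter_upwards [Lp.coeFn_smul (W i j) (G (α j) (z j) + X j),
        Lp.coeFn_add (G (α j) (z j)) (X j), hG (α j) (hα j) (z j), hX j] with ω h1 h2 h3 h4
      rw [h1, Pi.smul_apply, h2, Pi.add_apply, h3, h4, smul_eq_mul]
    filter_upwards [h1, Lp.coeFn_smul (1 / (N : ℝ)) (∑ j, W i j • (G (α j) (z j) + X j)),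
      Lp.coeFn_finsetSum Finset.univ (fun j => W i j • (G (α j) (z j) + X j))] with ω h1 h2 h3
    rw [h2, Pi.smul_apply, h3, smul_eq_mul]
    simp only [Finset.sum_apply, h1]
  constructor
  · intro h i
    exact Lp.ext ((h i).trans (key i).symm)
  · intro h i
    have := key i
    rwa [← h i] at this

/-- Independence and centring make the shocks orthogonal, so Pythagoras applies. This is where the
shocks average out. -/
theorem exists_shockLp {μ₀ : Measure ℝ} (hμ₀ : CenteredSquareIntegrable μ₀)
    (hξ : ∀ i, HasLaw (ξ i) μ₀ P) (hind : iIndepFun ξ P) :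
    ∃ X : Fin N → Lp ℝ 2 P, (∀ j, (X j : Ω → ℝ) =ᵐ[P] ξ j) ∧
      ∀ c : Fin N → ℝ, ‖∑ j, c j • X j‖ ^ 2 = (∫ t, t ^ 2 ∂μ₀) * ∑ j, c j ^ 2 := by
  have hmem : ∀ j, MemLp (ξ j) 2 P := fun j => by
    have h := hμ₀.1
    rw [← (hξ j).map_eq, memLp_map_measure_iff aestronglyMeasurable_id (hξ j).aemeasurable] at h
    exact h
  have hself : ∀ j, inner ℝ ((hmem j).toLp _) ((hmem j).toLp _) = ∫ t, t ^ 2 ∂μ₀ := fun j => by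
    rw [inner_toLp]
    simp only [← sq]
    exact (hξ j).integral_comp (f := fun t : ℝ => t ^ 2) (by fun_prop)
  have hcross : ∀ j k, j ≠ k → inner ℝ ((hmem j).toLp _) ((hmem k).toLp _) = 0 :=
    fun j k hjk => by
      have hi := (hind.indepFun hjk).integral_mul_eq_mul_integral (hmem j).1 (hmem k).1
      have h0 : ∫ ω, ξ j ω ∂P = 0 := by
        rw [(hξ j).integral_eq, hμ₀.2]
      rw [inner_toLp]
      refine hi.trans ?_
      rw [h0, zero_mul]
  refine ⟨fun j => (hmem j).toLp _, fun j => (hmem j).coeFn_toLp, fun c => ?_⟩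
  rw [← real_inner_self_eq_norm_sq, sum_inner, Finset.mul_sum]
  refine Finset.sum_congr rfl fun j _ => ?_
  rw [inner_sum, Finset.sum_eq_single j]
  · rw [real_inner_smul_left, real_inner_smul_right, hself]
    ring
  · intro k _ hkj
    rw [real_inner_smul_left, real_inner_smul_right, hcross j k hkj.symm]
    ring
  · simp

/-- A solution exists by contraction, so the `Classical.epsilon` choice is one. -/
theorem aggregate_spec {G : ℝ → Lp ℝ 2 P → Lp ℝ 2 P}
    (hG : ∀ α ∈ A, ∀ x, (G α x : Ω → ℝ) =ᵐ[P] fun ω => b α (x ω))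
    (hGlip : ∀ α ∈ A, ∀ x y, ‖G α x - G α y‖ ≤ √cz * ‖x - y‖) {X : Fin N → Lp ℝ 2 P}
    (hX : ∀ j, (X j : Ω → ℝ) =ᵐ[P] ξ j) (hcz : 0 ≤ cz) (hsmall : cz * frobeniusSq W < 1)
    {α : Fin N → ℝ} (hα : ∀ j, α j ∈ A) (i : Fin N) :
    aggregate b P ξ W α i =
      (1 / (N : ℝ)) • ∑ j, W i j • (G (α j) (aggregate b P ξ W α j) + X j) := by
  obtain ⟨z, hz⟩ := exists_interaction_fixedPoint W (G := fun j x => G (α j) x + X j)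
    (Real.sqrt_nonneg cz) (fun j x y => by simpa using hGlip (α j) (hα j) x y)
    (by rwa [Real.sq_sqrt hcz])
  have hex : ∃ z, IsAggregate b P ξ W α z := ⟨z, (isAggregate_iff hG hX hα z).2 hz⟩
  exact (isAggregate_iff hG hX hα _).1 (Classical.epsilon_spec hex) i

/-- The aggregates are close to the deterministic aggregates of the same profile. -/
theorem sum_norm_aggregate_sub_const_le [IsProbabilityMeasure P]
    {G : ℝ → Lp ℝ 2 P → Lp ℝ 2 P}
    (hG : ∀ α ∈ A, ∀ x, (G α x : Ω → ℝ) =ᵐ[P] fun ω => b α (x ω))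
    (hGlip : ∀ α ∈ A, ∀ x y, ‖G α x - G α y‖ ≤ √cz * ‖x - y‖) {X : Fin N → Lp ℝ 2 P}
    (hX : ∀ j, (X j : Ω → ℝ) =ᵐ[P] ξ j) {v : ℝ}
    (hXnorm : ∀ c : Fin N → ℝ, ‖∑ j, c j • X j‖ ^ 2 = v * ∑ j, c j ^ 2)
    (hcz : 0 ≤ cz) {ρ : ℝ} (hρ : 2 * cz * frobeniusSq W ≤ ρ) (hρ1 : ρ < 1)
    (hsmall : cz * frobeniusSq W < 1) {α : Fin N → ℝ} (hα : ∀ j, α j ∈ A) {zbar : Fin N → ℝ}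
    (hzbar : ∀ i, zbar i = (1 / (N : ℝ)) * ∑ j, W i j * b (α j) (zbar j)) :
    ∑ i, ‖aggregate b P ξ W α i - Lp.const 2 P (zbar i)‖ ^ 2 ≤
      2 / (1 - ρ) * (v * frobeniusSq W) := by
  have hGconst : ∀ j, G (α j) (Lp.const 2 P (zbar j)) = Lp.const 2 P (b (α j) (zbar j)) := by
    intro j
    refine Lp.ext ?_
    filter_upwards [hG (α j) (hα j) (Lp.const 2 P (zbar j)),
      Lp.coeFn_const (p := 2) (μ := P) (zbar j),
      Lp.coeFn_const (p := 2) (μ := P) (b (α j) (zbar j))] with ω h1 h2 h3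
    rw [h1, h2, h3]
    rfl
  have hzbarLp : ∀ i, Lp.const 2 P (zbar i) =
      (1 / (N : ℝ)) • ∑ j, W i j • G (α j) (Lp.const 2 P (zbar j)) := by
    intro i
    simp only [hGconst]
    have h : ∀ c : ℝ, Lp.const 2 P c = Lp.constL 2 P ℝ c := fun _ => rfl
    simp only [h, ← map_smul, ← map_sum, smul_eq_mul]
    exact congrArg _ (hzbar i)
  -- Subtracting the two systems leaves the interaction applied to the shocks as the only
  -- perturbation.
  have h := interaction_stability W
    (d := fun i => aggregate b P ξ W α i - Lp.const 2 P (zbar i))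
    (u := fun j => G (α j) (aggregate b P ξ W α j) - G (α j) (Lp.const 2 P (zbar j)))
    (e := fun i => (1 / (N : ℝ)) • ∑ j, W i j • X j)
    (fun i => by
      conv_lhs => rw [aggregate_spec hG hGlip hX hcz hsmall hα i, hzbarLp i]
      simp only [smul_sub, smul_add, Finset.sum_add_distrib, Finset.sum_sub_distrib]
      abel)
    (fun j => hGlip (α j) (hα j) _ _) hcz hρ hρ1
  refine h.trans_eq ?_
  congr 1
  have h1 : ∀ i, ‖(1 / (N : ℝ)) • ∑ j, W i j • X j‖ ^ 2 =
      v * ((1 / (N : ℝ) ^ 2) * ∑ j, W i j ^ 2) := fun i => by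
    rw [norm_smul, mul_pow, hXnorm, Real.norm_eq_abs, sq_abs]
    ring
  simp only [h1]
  rw [← Finset.mul_sum, ← Finset.mul_sum, frobeniusSq]
  ring

/-- The effect of a deviation of player `i` on all the aggregates. -/
theorem sum_norm_aggregate_update_sub_le {G : ℝ → Lp ℝ 2 P → Lp ℝ 2 P}
    (hG : ∀ α ∈ A, ∀ x, (G α x : Ω → ℝ) =ᵐ[P] fun ω => b α (x ω))
    (hGlip : ∀ α ∈ A, ∀ x y, ‖G α x - G α y‖ ≤ √cz * ‖x - y‖)
    (hGbdd : ∀ α ∈ A, ∀ α' ∈ A, ∀ x y, ‖G α x - G α' y‖ ≤ 2 * c₀) {X : Fin N → Lp ℝ 2 P}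
    (hX : ∀ j, (X j : Ω → ℝ) =ᵐ[P] ξ j)
    (hcz : 0 ≤ cz) {ρ : ℝ} (hρ : 2 * cz * frobeniusSq W ≤ ρ) (hρ1 : ρ < 1)
    (hsmall : cz * frobeniusSq W < 1) {α : Fin N → ℝ} (hα : ∀ j, α j ∈ A) (i : Fin N) {β : ℝ}
    (hβ : β ∈ A) :
    ∑ k, ‖aggregate b P ξ W (Function.update α i β) k - aggregate b P ξ W α k‖ ^ 2 ≤
      2 / (1 - ρ) * ((2 * c₀) ^ 2 * (∑ k, W k i ^ 2) / (N : ℝ) ^ 2) := by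
  set α' := Function.update α i β with hα'
  have hα'A : ∀ j, α' j ∈ A := fun j => by
    by_cases h : j = i
    · subst h; simpa [hα'] using hβ
    · simpa [hα', h] using hα j
  set z := aggregate b P ξ W α
  -- With the aggregates frozen at `z`, the deviation changes the drift of player `i` alone.
  -- Inserting `G (α' j) (z j)` separates this direct effect from the Lipschitz feedback.
  have hdiff : ∀ k, ∑ j, W k j • (G (α' j) (z j) - G (α j) (z j)) =
      W k i • (G β (z i) - G (α i) (z i)) := fun k => by
    rw [Finset.sum_eq_single i]
    · simp [hα']
    · intro j _ hj
      simp [hα', hj]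
    · simp
  have h := interaction_stability W
    (d := fun k => aggregate b P ξ W α' k - z k)
    (u := fun j => G (α' j) (aggregate b P ξ W α' j) - G (α' j) (z j))
    (e := fun k => (1 / (N : ℝ)) • W k i • (G β (z i) - G (α i) (z i)))
    (fun k => by
      have e1 := aggregate_spec hG hGlip hX hcz hsmall hα'A k
      have e2 : z k = _ := aggregate_spec hG hGlip hX hcz hsmall hα k
      conv_lhs => rw [e1, e2]
      rw [← hdiff k, ← smul_sub, ← smul_add, ← Finset.sum_sub_distrib, ← Finset.sum_add_distrib]
      congr 1
      refine Finset.sum_congr rfl fun j _ => ?_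
      rw [← smul_sub, ← smul_add]
      congr 1
      abel)
    (fun j => hGlip (α' j) (hα'A j) _ _) hcz hρ hρ1
  refine h.trans (mul_le_mul_of_nonneg_left ?_ (div_nonneg zero_le_two (by linarith)))
  rw [Finset.mul_sum, Finset.sum_div]
  refine Finset.sum_le_sum fun k _ => ?_
  have hb := pow_le_pow_left₀ (norm_nonneg _) (hGbdd β hβ (α i) (hα i) (z i) (z i)) 2
  rw [norm_smul, norm_smul, mul_pow, mul_pow, Real.norm_eq_abs, Real.norm_eq_abs, sq_abs, sq_abs]
  calc (1 / (N : ℝ)) ^ 2 * (W k i ^ 2 * ‖G β (z i) - G (α i) (z i)‖ ^ 2)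
      ≤ (1 / (N : ℝ)) ^ 2 * (W k i ^ 2 * (2 * c₀) ^ 2) := by gcongr
    _ = _ := by ring

/-- At a finite-player equilibrium, the actions are on average close to the best replies to the
deterministic aggregates. -/
theorem exists_aggregate_sum_sq_le [IsProbabilityMeasure P]
    {f : ℝ → ℝ → ℝ → ℝ} {μ₀ : Measure ℝ} {lc lJt ρ : ℝ}
    (hA : A.Nonempty) (hAc : IsClosed A) (hμ₀ : CenteredSquareIntegrable μ₀)
    (hb : LipschitzDrift A b cα cz) (hb_bdd : BoundedDrift A b c₀)
    (hf : CostIntegrable A b f μ₀) (hJt : CostLawLipschitz A b f μ₀ lJt)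
    (hlc : 0 < lc) {a : ℝ → ℝ} (haA : ∀ z, a z ∈ A)
    (hgrowth : ∀ z, ∀ β ∈ A, cost b f μ₀ (a z) z + lc / 2 * (β - a z) ^ 2 ≤ cost b f μ₀ β z)
    (hξ : ∀ i, HasLaw (ξ i) μ₀ P) (hind : iIndepFun ξ P)
    (hρ : 2 * cz * frobeniusSq W ≤ ρ) (hρ1 : ρ < 1) {α : Fin N → ℝ}
    (hα : IsNash A b f P ξ W α) :
    ∃ zbar : Fin N → ℝ, (∀ i, zbar i = (1 / (N : ℝ)) * ∑ j, W i j * b (α j) (zbar j)) ∧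
      ∑ i, (α i - a (zbar i)) ^ 2 ≤
        2 * |lJt| / lc * (2 * √(2 / (1 - ρ) * ∫ t, t ^ 2 ∂μ₀) + √(2 / (1 - ρ) * (2 * c₀) ^ 2)) *
          √(N * frobeniusSq W) := by
  have hcz := hb.2.1
  have hF := frobeniusSq_nonneg W
  have hρ' : 0 < 1 - ρ := by linarith
  have hsmall : cz * frobeniusSq W < 1 := by
    have := mul_nonneg hcz hF
    linarith
  obtain ⟨G, hG, hGlip, hGbdd⟩ := exists_driftLp P hb hb_bdd hA hAc
  obtain ⟨X, hX, hXnorm⟩ := exists_shockLp hμ₀ hξ hind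
  obtain ⟨zbar, hzbar⟩ := exists_interaction_fixedPoint W (G := fun j => b (α j))
    (Real.sqrt_nonneg cz) (fun j x y => hb.abs_sub_le_right (hα.1 j) x y)
    (by rwa [Real.sq_sqrt hcz])
  simp only [smul_eq_mul] at hzbar
  refine ⟨zbar, hzbar, ?_⟩
  set z := aggregate b P ξ W α with hz
  set d : Fin N → Lp ℝ 2 P := fun i => z i - Lp.const 2 P (zbar i) with hd
  set δ : Fin N → Lp ℝ 2 P := fun i =>
    aggregate b P ξ W (Function.update α i (a (zbar i))) i - z i with hδ
  -- The sum of squares is bounded by a multiple of `frobeniusSq W`; Cauchy–Schwarz costs the factor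
  -- `√N`, which the later division by `N` outweighs.
  have hdsum : ∑ i, ‖d i‖ ≤ √(2 / (1 - ρ) * ∫ t, t ^ 2 ∂μ₀) * √(N * frobeniusSq W) := by
    refine (sum_norm_le_sqrt d).trans ?_
    rw [← Real.sqrt_mul (mul_nonneg (by positivity) (integral_nonneg fun _ => sq_nonneg _))]
    refine Real.sqrt_le_sqrt ?_
    have := sum_norm_aggregate_sub_const_le hG hGlip hX hXnorm hcz hρ hρ1 hsmall hα.1 hzbar
    calc (N : ℝ) * ∑ i, ‖d i‖ ^ 2
        ≤ N * (2 / (1 - ρ) * ((∫ t, t ^ 2 ∂μ₀) * frobeniusSq W)) := by gcongr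
      _ = _ := by ring
  have hδsum : ∑ i, ‖δ i‖ ≤ √(2 / (1 - ρ) * (2 * c₀) ^ 2) * √(N * frobeniusSq W) := by
    refine (sum_norm_le_sqrt δ).trans ?_
    rw [← Real.sqrt_mul (by positivity)]
    refine Real.sqrt_le_sqrt ?_
    -- Of the response to the deviation of `i` only its own aggregate is kept. Summed over `i`, the
    -- column bounds reassemble the full Frobenius norm.
    have h1 : ∀ i, ‖δ i‖ ^ 2 ≤
        2 / (1 - ρ) * ((2 * c₀) ^ 2 * (∑ k, W k i ^ 2) / (N : ℝ) ^ 2) := fun i =>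
      (Finset.single_le_sum (f := fun k => ‖aggregate b P ξ W
        (Function.update α i (a (zbar i))) k - z k‖ ^ 2) (fun _ _ => sq_nonneg _)
        (Finset.mem_univ i)).trans
      (sum_norm_aggregate_update_sub_le hG hGlip hGbdd hX hcz hρ hρ1 hsmall hα.1 i
        (haA (zbar i)))
    have h2 : ∑ i, ‖δ i‖ ^ 2 ≤ 2 / (1 - ρ) * (2 * c₀) ^ 2 * frobeniusSq W := by
      refine (Finset.sum_le_sum fun i _ => h1 i).trans_eq ?_
      rw [← Finset.mul_sum, ← Finset.sum_div, ← Finset.mul_sum, Finset.sum_comm, frobeniusSq]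
      ring
    calc (N : ℝ) * ∑ i, ‖δ i‖ ^ 2
        ≤ N * (2 / (1 - ρ) * (2 * c₀) ^ 2 * frobeniusSq W) := by gcongr
      _ = _ := by ring
  -- Pass from `cost (α i) (zbar i)` to the player's cost (error `‖d i‖`), use the Nash inequality,
  -- and return to `cost (a (zbar i)) (zbar i)` (error `‖δ i‖ + ‖d i‖`). Quadratic growth converts
  -- the total error into a squared distance.
  have hpoint : ∀ i, (α i - a (zbar i)) ^ 2 ≤ 2 * |lJt| / lc * (2 * ‖d i‖ + ‖δ i‖) := by
    intro i
    have hβ := haA (zbar i)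
    set zβ := aggregate b P ξ W (Function.update α i (a (zbar i)))
    have h1 := hα.2 i _ hβ
    simp only [playerCost, Function.update_self] at h1
    have h2 := abs_expectedCost_sub_le hf hJt (hξ i) (hα.1 i) (z i) (Lp.const 2 P (zbar i))
    have h3 := abs_expectedCost_sub_le hf hJt (hξ i) hβ (zβ i) (Lp.const 2 P (zbar i))
    rw [← cost_eq_expectedCost_const hf (hξ i) (hα.1 i)] at h2
    rw [← cost_eq_expectedCost_const hf (hξ i) hβ] at h3
    have h4 := hgrowth (zbar i) (α i) (hα.1 i)
    have h5 : ‖zβ i - Lp.const 2 P (zbar i)‖ ≤ ‖δ i‖ + ‖d i‖ := by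
      have : zβ i - Lp.const 2 P (zbar i) = δ i + d i := by simp [hδ, hd, zβ]
      rw [this]
      exact norm_add_le _ _
    have h6 := (le_abs_self _).trans h2
    have h7 := (neg_le_abs _).trans h3
    have h8 := mul_le_mul_of_nonneg_left h5 (abs_nonneg lJt)
    rw [div_mul_eq_mul_div, le_div_iff₀ hlc]
    have h9 : ‖z i - Lp.const 2 P (zbar i)‖ = ‖d i‖ := rfl
    rw [h9] at h6
    nlinarith
  refine (Finset.sum_le_sum fun i _ => hpoint i).trans ?_
  rw [← Finset.mul_sum, Finset.sum_add_distrib, ← Finset.mul_sum, mul_assoc]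
  refine mul_le_mul_of_nonneg_left ?_ (by positivity)
  linarith

end FinitePlayer

/-! ### Step functions and step graphons -/

section Step

variable {N : ℕ}

/-- The interval `[i/N, (i+1)/N)` in the unit interval. -/
def cell (N : ℕ) (i : Fin N) : Set I := {x | ⌊(N : ℝ) * (x : ℝ)⌋₊ = i}

theorem measurableSet_cell (i : Fin N) : MeasurableSet (cell N i) := by
  have h : Measurable (fun x : I => ⌊(N : ℝ) * (x : ℝ)⌋₊) :=
    Nat.measurable_floor.comp (measurable_subtype_coe.const_mul _)
  exact h (measurableSet_singleton _)

theorem volume_cell (i : Fin N) : (volume : Measure I).real (cell N i) = 1 / (N : ℝ) := by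
  have hN : (0 : ℝ) < N := by exact_mod_cast i.pos
  have hi : (i : ℝ) + 1 ≤ N := by exact_mod_cast i.2
  have h0 : (i : ℝ) / N ∈ I := ⟨by positivity, by rw [div_le_one hN]; linarith⟩
  have h1 : ((i : ℝ) + 1) / N ∈ I := ⟨by positivity, by rwa [div_le_one hN]⟩
  have hcell : cell N i = Set.Ico ⟨_, h0⟩ ⟨_, h1⟩ := by
    ext x
    have hx : 0 ≤ (N : ℝ) * x := mul_nonneg hN.le x.2.1
    simp only [cell, Set.mem_ofPred_eq, Set.mem_Ico, ← Subtype.coe_le_coe, ← Subtype.coe_lt_coe]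
    rw [Nat.floor_eq_iff hx, div_le_iff₀ hN, lt_div_iff₀ hN, mul_comm]
  rw [hcell, Measure.real, unitInterval.volume_Ico, ENNReal.toReal_ofReal]
  · change ((i : ℝ) + 1) / N - (i : ℝ) / N = _
    ring
  · change 0 ≤ ((i : ℝ) + 1) / N - (i : ℝ) / N
    rw [← sub_div, add_sub_cancel_left]
    positivity

theorem stepFun_eq_sum (α : Fin N → ℝ) :
    stepFun α = fun x => ∑ i, (cell N i).indicator (fun _ => α i) x := by
  funext x
  rw [stepFun]
  split_ifs with h
  · rw [Finset.sum_eq_single ⟨_, h⟩]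
    · simp [cell]
    · intro j _ hj
      refine Set.indicator_of_notMem (fun hx => hj ?_) _
      exact Fin.ext (Eq.symm hx)
    · simp
  · refine (Finset.sum_eq_zero fun i _ => Set.indicator_of_notMem (fun hx => h ?_) _).symm
    rw [show ⌊(N : ℝ) * (x : ℝ)⌋₊ = i from hx]
    exact i.2

theorem measurable_stepFun (α : Fin N → ℝ) : Measurable (stepFun α) := by
  rw [stepFun_eq_sum]
  exact Finset.measurable_sum _ fun i _ => measurable_const.indicator (measurableSet_cell i)

theorem integral_stepFun (α : Fin N → ℝ) : ∫ x, stepFun α x = (1 / (N : ℝ)) * ∑ i, α i := by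
  rw [stepFun_eq_sum, integral_finsetSum _ fun i _ =>
    (integrable_const _).indicator (measurableSet_cell i), Finset.mul_sum]
  refine Finset.sum_congr rfl fun i _ => ?_
  rw [integral_indicator_const _ (measurableSet_cell i), volume_cell, smul_eq_mul]

/-- The index depends only on `x`, so one case split evaluates every step function and every step
graphon at once. -/
theorem stepFun_zero_or (x : I) :
    (∀ α : Fin N → ℝ, stepFun α x = 0) ∨ ∃ i, ∀ α : Fin N → ℝ, stepFun α x = α i := by
  by_cases h : ⌊(N : ℝ) * (x : ℝ)⌋₊ < N
  · exact Or.inr ⟨⟨_, h⟩, fun α => by rw [stepFun, dif_pos h]⟩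
  · exact Or.inl fun α => by rw [stepFun, dif_neg h]

theorem ae_exists_stepFun (hN : 0 < N) :
    ∀ᵐ x : I, ∃ i, ∀ α : Fin N → ℝ, stepFun α x = α i := by
  have h1 : ∀ᵐ x : I, x ≠ 1 := by
    simp [ae_iff]
  filter_upwards [h1] with x hx
  have hx1 : (x : ℝ) < 1 := lt_of_le_of_ne x.2.2 fun h => hx (Subtype.ext h)
  have hN' : (0 : ℝ) < N := by exact_mod_cast hN
  have h : ⌊(N : ℝ) * (x : ℝ)⌋₊ < N := by
    rw [Nat.floor_lt (mul_nonneg hN'.le x.2.1)]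
    nlinarith
  exact ⟨⟨_, h⟩, fun α => by rw [stepFun, dif_pos h]⟩

theorem abs_stepFun_le {α : Fin N → ℝ} {c : ℝ} (hc : 0 ≤ c) (h : ∀ i, |α i| ≤ c) (x : I) :
    |stepFun α x| ≤ c := by
  rcases stepFun_zero_or (N := N) x with h0 | ⟨i, hi⟩
  · rwa [h0, abs_zero]
  · rw [hi]
    exact h i

theorem abs_le_sum_abs (α : Fin N → ℝ) (i : Fin N) : |α i| ≤ ∑ j, |α j| :=
  Finset.single_le_sum (f := fun j => |α j|) (fun _ _ => abs_nonneg _) (Finset.mem_univ i)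

theorem memLp_stepFun (α : Fin N → ℝ) : MemLp (stepFun α) 2 volume :=
  MemLp.of_bound (measurable_stepFun α).aestronglyMeasurable (∑ j, |α j|)
    (Eventually.of_forall
      (abs_stepFun_le (Finset.sum_nonneg fun _ _ => abs_nonneg _) (abs_le_sum_abs α)))

theorem normL2_stepFun_sq (α : Fin N → ℝ) :
    normL2 (stepFun α) ^ 2 = (1 / (N : ℝ)) * ∑ i, α i ^ 2 := by
  rw [normL2_sq (memLp_stepFun α), ← integral_stepFun]
  congr 1
  funext x
  rcases stepFun_zero_or (N := N) x with h | ⟨i, h⟩ <;> simp [h]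

theorem measurable_stepGraphon (W : Matrix (Fin N) (Fin N) ℝ) :
    Measurable (fun p : I × I => stepGraphon W p.1 p.2) := by
  have h : (fun p : I × I => stepGraphon W p.1 p.2) = fun p : I × I =>
      ∑ i, (cell N i).indicator (fun _ => (1 : ℝ)) p.1 * stepFun (W i) p.2 := by
    funext p
    rw [stepGraphon, stepFun_eq_sum]
    refine Finset.sum_congr rfl fun i _ => ?_
    by_cases hp : p.1 ∈ cell N i <;> simp [hp]
  rw [h]
  refine Finset.measurable_sum _ fun i _ => ?_
  exact ((measurable_const.indicator (measurableSet_cell i)).comp measurable_fst).mul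
    ((measurable_stepFun (W i)).comp measurable_snd)

theorem isGraphon_stepGraphon {W : Matrix (Fin N) (Fin N) ℝ} (hW : W.IsSymm) :
    IsGraphon (stepGraphon W) where
  symm x y := by
    rcases stepFun_zero_or (N := N) x with hx | ⟨i, hx⟩ <;>
      rcases stepFun_zero_or (N := N) y with hy | ⟨j, hy⟩ <;>
      simp [stepGraphon, hx, hy, hW.apply]
  measurable := measurable_stepGraphon W
  integrable_sq := by
    have hM : 0 ≤ ∑ i, ∑ j, |W i j| :=
      Finset.sum_nonneg fun _ _ => Finset.sum_nonneg fun _ _ => abs_nonneg _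
    refine (MemLp.of_bound (measurable_stepGraphon W).aestronglyMeasurable
      (∑ i, ∑ j, |W i j|) (Eventually.of_forall fun p => ?_)).integrable_sq
    refine abs_stepFun_le hM (fun i => abs_stepFun_le hM (fun j => ?_) _) _
    exact (abs_le_sum_abs (W i) j).trans (Finset.single_le_sum
      (f := fun i => ∑ j, |W i j|) (fun _ _ => Finset.sum_nonneg fun _ _ => abs_nonneg _)
      (Finset.mem_univ i))

theorem integral_stepGraphon (M : Matrix (Fin N) (Fin N) ℝ) (x : I) :
    ∫ y, stepGraphon M x y = stepFun (fun i => (1 / (N : ℝ)) * ∑ j, M i j) x := by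
  rcases stepFun_zero_or (N := N) x with hx | ⟨i, hx⟩
  · simp [stepGraphon, hx]
  · simp only [stepGraphon, hx, integral_stepFun]

/-- The dictionary between the two games: the operator of a step graphon acts on step functions as
the matrix `W / N`. -/
theorem graphonOp_stepGraphon (W : Matrix (Fin N) (Fin N) ℝ) (u : Fin N → ℝ) :
    graphonOp (stepGraphon W) (stepFun u) =
      stepFun (fun i => (1 / (N : ℝ)) * ∑ j, W i j * u j) := by
  funext x
  refine Eq.trans ?_ (integral_stepGraphon (Matrix.of fun i j => W i j * u j) x)
  rw [graphonOp]
  congr 1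
  funext y
  rcases stepFun_zero_or (N := N) x with hx | ⟨i, hx⟩ <;>
    rcases stepFun_zero_or (N := N) y with hy | ⟨j, hy⟩ <;>
    simp [stepGraphon, hx, hy]

theorem graphonNorm_stepGraphon_sq {W : Matrix (Fin N) (Fin N) ℝ} (hW : W.IsSymm) :
    graphonNorm (stepGraphon W) ^ 2 = frobeniusSq W := by
  have h_int := (isGraphon_stepGraphon hW).integrable_sq
  rw [Measure.volume_eq_prod] at h_int
  rw [graphonNorm_sq, Measure.volume_eq_prod, integral_prod _ h_int]
  have h1 : ∀ x y, stepGraphon W x y ^ 2 = stepGraphon (Matrix.of fun i j => W i j ^ 2) x y := by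
    intro x y
    rcases stepFun_zero_or (N := N) x with hx | ⟨i, hx⟩ <;>
      rcases stepFun_zero_or (N := N) y with hy | ⟨j, hy⟩ <;>
      simp [stepGraphon, hx, hy]
  simp only [h1, integral_stepGraphon, integral_stepFun, ← Finset.mul_sum, frobeniusSq,
    Matrix.of_apply]
  ring

end Step

/-! ### Convergence of the equilibria -/

theorem distS_le (α α' : I → ℝ) (φ : MPEquiv) :
    distS α α' ≤ normL2 (fun x => α (φ.1 x) - α' x) :=
  ciInf_le ⟨0, by rintro _ ⟨ψ, rfl⟩; exact normL2_nonneg _⟩ φ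

theorem distS_nonneg (α α' : I → ℝ) : 0 ≤ distS α α' := Real.iInf_nonneg fun _ => normL2_nonneg _

/-- The distance between a finite profile of approximate best replies and the equilibrium of the
graphon game. -/
theorem distS_stepFun_le {A : Set ℝ} {b : ℝ → ℝ → ℝ} {cα cz c₀ κ : ℝ}
    (hb : LipschitzDrift A b cα cz) (hb_bdd : BoundedDrift A b c₀)
    (hA : A.Nonempty) (hAc : IsClosed A) {w : I → I → ℝ} (hw : IsGraphon w)
    (hκ : 0 ≤ κ) {a : ℝ → ℝ} (haA : ∀ z, a z ∈ A)
    (halip : ∀ z z', |a z - a z'| ≤ κ * |z - z'|)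
    (hcontr : graphonOpNorm w * (√cα * κ + √cz) < 1)
    {αhat z : Lp ℝ 2 (volume : Measure I)} (hαhat : αhat =ᵐ[volume] fun x => a (z x))
    (hz : ∀ᵐ x, z x = ∫ y, w x y * b (a (z y)) (z y))
    {N : ℕ} (hN : 0 < N) {W : Matrix (Fin N) (Fin N) ℝ} (hW : W.IsSymm) {α zbar : Fin N → ℝ}
    (hα : ∀ i, α i ∈ A)
    (hzbar : ∀ i, zbar i = (1 / (N : ℝ)) * ∑ j, W i j * b (α j) (zbar j)) (φ : MPEquiv) :
    distS (stepFun α) αhat ≤ normL2 (stepFun fun i => α i - a (zbar i)) +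
      κ * ((graphonOpNorm w * √cα * normL2 (stepFun fun i => α i - a (zbar i)) +
        c₀ * graphonNorm (fun x y => stepGraphon W (φ.1 x) (φ.1 y) - w x y)) /
        (1 - graphonOpNorm w * (√cα * κ + √cz))) := by
  set e : Fin N → ℝ := fun i => α i - a (zbar i) with he
  set B : Fin N → ℝ := fun i => b (α i) (zbar i) with hB
  set wφ : I → I → ℝ := fun x y => stepGraphon W (φ.1 x) (φ.1 y) with hwφ
  have hwφg : IsGraphon wφ := (isGraphon_stepGraphon hW).comp φ
  have hmem : ∀ u : Fin N → ℝ, MemLp (fun x => stepFun u (φ.1 x)) 2 volume := fun u =>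
    (memLp_stepFun u).comp_measurePreserving φ.2
  have hae : ∀ᵐ x, ∃ i, ∀ u : Fin N → ℝ, stepFun u (φ.1 x) = u i :=
    φ.2.quasiMeasurePreserving.ae (ae_exists_stepFun hN)
  have hnorm_e : normL2 (fun x => stepFun e (φ.1 x)) = normL2 (stepFun e) :=
    normL2_comp φ.2 (memLp_stepFun e).1
  have hac : Continuous a :=
    (LipschitzWith.of_dist_le_mul (K := ⟨κ, hκ⟩) fun z z' => halip z z').continuous
  have hBz : MemLp (fun y => b (a (z y)) (z y)) 2 volume :=
    memLp_drift hb hb_bdd hA hAc (hac.comp_aestronglyMeasurable (Lp.aestronglyMeasurable z))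
      (Lp.aestronglyMeasurable z) (Eventually.of_forall fun _ => haA _)
  set D : ℝ := normL2 (fun x => stepFun zbar (φ.1 x) - z x) with hD
  have hDmem : MemLp (fun x => stepFun zbar (φ.1 x) - z x) 2 volume := (hmem zbar).sub (Lp.memLp z)
  set R : ℝ := graphonNorm (fun x y => wφ x y - w x y) with hR
  -- The action `α i` is compared with `a (z x)` through `a (zbar i)`, at the price of the
  -- best-reply error `e`.
  have hvB : normL2 (fun y => stepFun B (φ.1 y) - b (a (z y)) (z y)) ≤
      (√cα * κ + √cz) * D + √cα * normL2 (stepFun e) := by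
    rw [← hnorm_e]
    refine normL2_le_of_abs_le (by positivity) (by positivity) hDmem (hmem e) ?_
    filter_upwards [hae] with x ⟨i, hi⟩
    simp only [hi]
    have h1 := hb.abs_sub_le (hα i) (haA (z x)) (zbar i) (z x)
    have h2 : |α i - a (z x)| ≤ |e i| + κ * |zbar i - z x| := by
      have h3 : α i - a (z x) = e i + (a (zbar i) - a (z x)) := by simp [he]
      rw [h3]
      exact (abs_add_le _ _).trans (by linarith [halip (zbar i) (z x)])
    have h4 := mul_le_mul_of_nonneg_left h2 (Real.sqrt_nonneg cα)
    simp only [hB]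
    nlinarith
  have hvnorm : normL2 (fun y => stepFun B (φ.1 y)) ≤ c₀ :=
    normL2_le_of_bound hb_bdd.1.le (Eventually.of_forall fun y =>
      abs_stepFun_le hb_bdd.1.le (fun i => hb_bdd.2 _ (hα i) _) _)
  have hDle : D ≤ graphonOpNorm w * ((√cα * κ + √cz) * D + √cα * normL2 (stepFun e)) + R * c₀ := by
    -- The difference of the equations is split so that the limit operator acts on the drift
    -- difference, where it contracts, while `wφ - w` acts only on the drift bounded by `c₀`.
    have hsplit : (fun x => stepFun zbar (φ.1 x) - z x) =ᵐ[volume] fun x =>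
        graphonOp w (fun y => stepFun B (φ.1 y) - b (a (z y)) (z y)) x +
          graphonOp (fun x y => wφ x y - w x y) (fun y => stepFun B (φ.1 y)) x := by
      filter_upwards [hz, hw.op_sub (hmem B) hBz, hwφg.sub_op hw (hmem B)] with x h1 h2 h3
      rw [← h2, ← h3, graphonOp_comp, graphonOp_stepGraphon, h1]
      have h4 : stepFun zbar = stepFun (fun i => (1 / (N : ℝ)) * ∑ j, W i j * B j) :=
        congrArg stepFun (funext hzbar)
      rw [h4]
      simp only [graphonOp]
      ring
    have hdiff : MemLp (fun y => stepFun B (φ.1 y) - b (a (z y)) (z y)) 2 volume :=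
      (hmem B).sub hBz
    refine (normL2_congr hsplit).le.trans ?_
    refine (normL2_add_le (hw.memLp_op hdiff) ((hwφg.sub hw).memLp_op (hmem B))).trans ?_
    refine add_le_add ((hw.normL2_op_le hdiff).trans ?_)
      (((hwφg.sub hw).normL2_op_le_graphonNorm (hmem B)).trans ?_)
    · exact mul_le_mul_of_nonneg_left hvB (graphonOpNorm_nonneg w)
    · exact mul_le_mul_of_nonneg_left hvnorm (graphonNorm_nonneg _)
  -- The contraction hypothesis allows the `D` term on the right to be absorbed.
  have hDbound : D ≤ (graphonOpNorm w * √cα * normL2 (stepFun e) + c₀ * R) /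
      (1 - graphonOpNorm w * (√cα * κ + √cz)) := by
    rw [le_div_iff₀ (by linarith)]
    nlinarith
  have hfinal : normL2 (fun x => stepFun α (φ.1 x) - αhat x) ≤
      1 * normL2 (fun x => stepFun e (φ.1 x)) + κ * D := by
    refine normL2_le_of_abs_le zero_le_one hκ (hmem e) hDmem ?_
    filter_upwards [hae, hαhat] with x ⟨i, hi⟩ hx
    rw [hx]
    simp only [hi, one_mul]
    have h3 : α i - a (z x) = e i + (a (zbar i) - a (z x)) := by simp [he]
    rw [h3]
    exact (abs_add_le _ _).trans (by linarith [halip (zbar i) (z x)])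
  rw [one_mul, hnorm_e] at hfinal
  refine (distS_le _ _ φ).trans (hfinal.trans ?_)
  have := mul_le_mul_of_nonneg_left hDbound hκ
  linarith

end GraphonGame

theorem mainTheorem1
    -- the data of the game
    (A : Set ℝ) (hA_nonempty : A.Nonempty) (hA_closed : IsClosed A) (hA_convex : Convex ℝ A)
    (b : ℝ → ℝ → ℝ) (f : ℝ → ℝ → ℝ → ℝ)
    (μ₀ : Measure ℝ) [IsProbabilityMeasure μ₀]
    (cα cz c₀ lc lJ lJt : ℝ)
    (hμ₀ : GraphonGame.CenteredSquareIntegrable μ₀)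
    (hb : GraphonGame.LipschitzDrift A b cα cz)
    (hb_bdd : GraphonGame.BoundedDrift A b c₀)
    (hf : GraphonGame.CostIntegrable A b f μ₀)
    (hJt : GraphonGame.CostLawLipschitz A b f μ₀ lJt)
    (hJ : GraphonGame.CostRegular A b f μ₀ lc lJ)
    -- the shocks of the `N`-player games
    (Ω : ℕ → Type*) [∀ N, MeasurableSpace (Ω N)]
    (P : ∀ N, Measure (Ω N)) [∀ N, IsProbabilityMeasure (P N)]
    (ξ : ∀ N, Fin N → Ω N → ℝ)
    (hξ_law : ∀ N i, HasLaw (ξ N i) μ₀ (P N))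
    (hξ_indep : ∀ N, iIndepFun (ξ N) (P N))
    -- the interaction matrices and the unique equilibria of the `N`-player games
    (W : ∀ N, Matrix (Fin N) (Fin N) ℝ) (hW : ∀ N, (W N).IsSymm)
    (αstar : ∀ N, Fin N → ℝ)
    (hαstar : ∀ᶠ N in atTop, GraphonGame.IsNash A b f (P N) (ξ N) (W N) (αstar N) ∧
      ∀ α, GraphonGame.IsNash A b f (P N) (ξ N) (W N) α → α = αstar N)
    -- the limiting graphon
    (w : I → I → ℝ) (hw : GraphonGame.IsGraphon w)
    (h_cut : Tendsto (fun N => GraphonGame.cutDist (GraphonGame.stepGraphon (W N)) w)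
      atTop (𝓝 0))
    (h_norm : Tendsto (fun N => GraphonGame.graphonNorm (GraphonGame.stepGraphon (W N)))
      atTop (𝓝 (GraphonGame.graphonNorm w)))
    (h_op : Tendsto (fun N => GraphonGame.graphonOpNorm (GraphonGame.stepGraphon (W N)))
      atTop (𝓝 (GraphonGame.graphonOpNorm w)))
    (h_small : √(2 * cz) * GraphonGame.graphonNorm w < 1)
    (h_small_op : √cz * GraphonGame.graphonOpNorm w < 1)
    (h_contr : lJ / lc * (√cα * GraphonGame.graphonOpNorm w /
      (1 - √cz * GraphonGame.graphonOpNorm w)) < 1) :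
    ∃ αhat : Lp ℝ 2 (volume : Measure I),
      (GraphonGame.IsGraphonNash A b f μ₀ w αhat ∧
        ∀ α, GraphonGame.IsGraphonNash A b f μ₀ w α → α = αhat) ∧
      Tendsto (fun N => GraphonGame.distS (GraphonGame.stepFun (αstar N)) αhat)
        atTop (𝓝 0) := by
  obtain ⟨a, haA, hgrowth, halip⟩ := hJ.exists_bestReply hA_nonempty hA_closed hA_convex
  have hlc := hJ.1
  have hκ : 0 ≤ lJ / lc := div_nonneg (hJ.lJ_nonneg hA_nonempty) hlc.le
  have hcontr : GraphonGame.graphonOpNorm w * (√cα * (lJ / lc) + √cz) < 1 := by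
    have hpos : 0 < 1 - √cz * GraphonGame.graphonOpNorm w := by linarith
    rw [← mul_div_assoc, div_lt_one hpos] at h_contr
    linarith
  obtain ⟨αhat, z, hαhat, hz, hnash, huniq⟩ := GraphonGame.existsUnique_graphonNash hb hb_bdd
    hA_nonempty hA_closed hw hlc hκ haA hgrowth halip h_small_op hcontr
  refine ⟨αhat, ⟨hnash, huniq⟩, ?_⟩
  obtain ⟨φ, hφ⟩ := GraphonGame.exists_relabelling hw
    (fun N => GraphonGame.isGraphon_stepGraphon (hW N)) h_cut h_norm
  have hfrob : Tendsto (fun N => GraphonGame.frobeniusSq (W N)) atTop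
      (𝓝 (GraphonGame.graphonNorm w ^ 2)) :=
    (h_norm.pow 2).congr fun N => GraphonGame.graphonNorm_stepGraphon_sq (hW N)
  have hlim : 2 * cz * GraphonGame.graphonNorm w ^ 2 < 1 := by
    have h0 : 0 ≤ √(2 * cz) * GraphonGame.graphonNorm w :=
      mul_nonneg (Real.sqrt_nonneg _) (GraphonGame.graphonNorm_nonneg w)
    have h1 := pow_lt_one₀ h0 h_small two_ne_zero
    rwa [mul_pow, Real.sq_sqrt (by linarith [hb.2.1])] at h1
  -- A fixed `ρ < 1` makes the stability constant `2 / (1 - ρ)` uniform in large `N`.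
  obtain ⟨ρ, hρ, hρ1⟩ := exists_between hlim
  have hsmall : ∀ᶠ N in atTop, 2 * cz * GraphonGame.frobeniusSq (W N) ≤ ρ :=
    (hfrob.const_mul (2 * cz)).eventually_le_const hρ
  set C : ℝ := 2 * |lJt| / lc *
    (2 * √(2 / (1 - ρ) * ∫ t, t ^ 2 ∂μ₀) + √(2 / (1 - ρ) * (2 * c₀) ^ 2)) with hC
  -- Stated as an implication so that `zbar` can be chosen for every `N`, with default `0` where the
  -- conditions fail.
  have hex : ∀ N, ∃ zbar : Fin N → ℝ, (0 < N ∧ 2 * cz * GraphonGame.frobeniusSq (W N) ≤ ρ ∧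
      GraphonGame.IsNash A b f (P N) (ξ N) (W N) (αstar N)) →
      (∀ i, zbar i = (1 / (N : ℝ)) * ∑ j, W N i j * b (αstar N j) (zbar j)) ∧
      ∑ i, (αstar N i - a (zbar i)) ^ 2 ≤ C * √(N * GraphonGame.frobeniusSq (W N)) := by
    intro N
    by_cases h : 0 < N ∧ 2 * cz * GraphonGame.frobeniusSq (W N) ≤ ρ ∧
      GraphonGame.IsNash A b f (P N) (ξ N) (W N) (αstar N)
    · obtain ⟨zbar, h1, h2⟩ := GraphonGame.exists_aggregate_sum_sq_le hA_nonempty hA_closed hμ₀ hb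
        hb_bdd hf hJt hlc haA hgrowth (hξ_law N) (hξ_indep N) h.2.1 hρ1 h.2.2
      exact ⟨zbar, fun _ => ⟨h1, h2⟩⟩
    · exact ⟨0, fun h' => absurd h' h⟩
  choose zbar hzbar using hex
  have hgood : ∀ᶠ N in atTop, 0 < N ∧ 2 * cz * GraphonGame.frobeniusSq (W N) ≤ ρ ∧
      GraphonGame.IsNash A b f (P N) (ξ N) (W N) (αstar N) := by
    filter_upwards [eventually_gt_atTop 0, hsmall, hαstar] with N h1 h2 h3
    exact ⟨h1, h2, h3.1⟩
  set e : ℕ → ℝ := fun N =>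
    GraphonGame.normL2 (GraphonGame.stepFun fun i => αstar N i - a (zbar N i)) with he_def
  have he : Tendsto e atTop (𝓝 0) := by
    have hsq : Tendsto (fun N => e N ^ 2) atTop (𝓝 0) := by
      -- The total error `C * √(N * frobeniusSq (W N))` divided by `N`; the Frobenius norms
      -- converge, so it decays like `1 / √N`.
      have hbound : Tendsto (fun N : ℕ =>
          C * (√(GraphonGame.frobeniusSq (W N)) * (√(N : ℝ))⁻¹)) atTop (𝓝 0) := by
        have h1 : Tendsto (fun N : ℕ => (√(N : ℝ))⁻¹) atTop (𝓝 0) :=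
          tendsto_inv_atTop_zero.comp
            (Real.tendsto_sqrt_atTop.comp tendsto_natCast_atTop_atTop)
        simpa using (hfrob.sqrt.mul h1).const_mul C
      refine squeeze_zero' (Eventually.of_forall fun _ => sq_nonneg _) ?_ hbound
      filter_upwards [hgood] with N hN
      have hN0 : (0 : ℝ) < N := by exact_mod_cast hN.1
      rw [he_def, GraphonGame.normL2_stepFun_sq]
      calc 1 / (N : ℝ) * ∑ i, (αstar N i - a (zbar N i)) ^ 2
          ≤ 1 / (N : ℝ) * (C * √(N * GraphonGame.frobeniusSq (W N))) := by
            gcongr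
            exact (hzbar N hN).2
        _ = _ := by
            rw [Real.sqrt_mul hN0.le]
            have hs : √(N : ℝ) ≠ 0 := (Real.sqrt_pos.2 hN0).ne'
            nth_rewrite 1 [← Real.mul_self_sqrt hN0.le]
            field_simp
    have := hsq.sqrt
    simpa only [Real.sqrt_sq (GraphonGame.normL2_nonneg _), Real.sqrt_zero, he_def] using this
  have hbound : Tendsto (fun N => e N + lJ / lc * ((GraphonGame.graphonOpNorm w * √cα * e N +
      c₀ * GraphonGame.graphonNorm (fun x y =>
        GraphonGame.stepGraphon (W N) ((φ N).1 x) ((φ N).1 y) - w x y)) /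
      (1 - GraphonGame.graphonOpNorm w * (√cα * (lJ / lc) + √cz)))) atTop (𝓝 0) := by
    simpa using he.add ((((he.const_mul (GraphonGame.graphonOpNorm w * √cα)).add
      (hφ.const_mul c₀)).div_const
      (1 - GraphonGame.graphonOpNorm w * (√cα * (lJ / lc) + √cz))).const_mul (lJ / lc))
  refine squeeze_zero' (Eventually.of_forall fun _ => GraphonGame.distS_nonneg _ _) ?_ hbound
  filter_upwards [hgood] with N hN
  exact GraphonGame.distS_stepFun_le hb hb_bdd hA_nonempty hA_closed hw hκ haA halip hcontr hαhat hz
    hN.1 (hW N) hN.2.2.1 (hzbar N hN).1 (φ N)
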